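/- Let $A\in\mathbb R^{m\times n}$, $b\in\mathbb R^m$, $c\in\mathbb R^n$, and consider the linear program $\min\{c^\top x: Ax=b,\ x\ge 0\}$. All norms and distances $\operatorname{Dist}$ are Euclidean unless indicated otherwise. Put $q:=A^\top(AA^\top)^\dagger b$, $V_p:=\{x: Ax=b\}$, $V_d:=c+\operatorname{Im}(A^\top)$, $F_p:=V_p\cap\mathbb R^n_+$, $F_d:=V_d\cap\mathbb R^n_+$, $X^\star:=\arg\min\{c^\top x: x\in F_p\}$ and $S^\star:=\arg\max\{q^\top(c-s): s\in F_d\}$ (the optimal dual slacks). Let $\lambda_{\max}$ and $\lambda_{\min}$ be the largest and smallest positive singular values of $A$ and $\kappa:=\lambda_{\max}/\lambda_{\min}$. *Condition measures.* For $x\in V_p$ let $\theta_p(x):=\operatorname{Dist}(x,F_p)/\operatorname{Dist}(x,\mathbb R^n_+)$ if $x\notin F_p$ and $\theta_p(x):=1$ if $x\in F_p$. Let $$\theta_p^\star:=\lim_{\varepsilon\downarrow0}\ \sup_{x\in V_p,\ \operatorname{Dist}(x,X^\star)\le\varepsilon}\theta_p(x),\qquad \mu_p:=\inf_{x\in F_p\setminus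 X^\star}\frac{\operatorname{Dist}(x,V_p\cap H_p^\star)}{\operatorname{Dist}(x,X^\star)},$$ where $H_p^\star:=\{x\in\mathbb R^n: c^\top x=c^\top x^\star\}$ for $x^\star\in X^\star$. Define $\theta_d^\star$ and $\mu_d$ in the same way from $V_d,F_d,S^\star$ and $H_d^\star:=\{s\in\mathbb R^n: q^\top(c-s)=q^\top(c-s^\star)\}$ for $s^\star\in S^\star$. Let $\mathcal E_d(x,s):=\max\{\operatorname{Dist}(x,X^\star),\operatorname{Dist}(s,S^\star)\}$. *Algorithm (rPDHG).* Let $\tau,\sigma>0$ be step-sizes. One PDHG step maps $z=(x,y)$ to $(x^+,y^+)$ with $x^+:=P_{\mathbb R^n_+}(x-\tau(c-A^\top y))$ and $y^+:=y+\sigma(b-A(2x^+-x))$. Let $L(x,y):=c^\top x+b^\top y-x^\top A^\top y$, let $\|z\|_M:=\sqrt{z^\top Mz}$ with $M:=\begin{pmatrix}\frac1\tau I&A^\top\\A&\frac1\sigma I\end{pmatrix}$, and for $r>0$ let $$\rho(r;z):=\frac1r\max\{L(x,\hat y)-L(\hat x,y):\ \hat z=(\hat x,\hat y),\ \hat x\ge0,\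 \|\hat z-z\|_M\le r\}.$$ Start from $z^{0,0}=(0,0)$. In the outer loop $N=0,1,2,\dots$, generate $z^{N,k+1}$ from $z^{N,k}$ by one PDHG step and put $\bar z^{N,k}:=\frac1k\sum_{i=1}^kz^{N,i}$. At the first $k\ge1$ at which the restart condition holds, put $z^{N+1,0}:=\bar z^{N,k}$ and begin outer loop $N+1$. The restart condition at $(N,k)$ is $k=1$ if $N=0$, and, if $N\ge1$, $$\rho(\|\bar z^{N,k}-z^{N,0}\|_M;\bar z^{N,k})\le\tfrac1e\,\rho(\|z^{N,0}-z^{N-1,0}\|_M;z^{N,0}).$$ Write $z^{N,0}=(x^{N,0},y^{N,0})$ and $s^{N,0}:=c-A^\top y^{N,0}$. The algorithm stops at the first $N$ with $\mathcal E_d(x^{N,0},s^{N,0})\le\varepsilon$. **Theorem.** Suppose that $Ac=0$, that $X^\star\neq\emptyset$, and that $F_p\setminus X^\star$ and $F_d\setminus S^\star$ are non-empty. Let rPDHG be run with $$\tau=\frac{\mu_d\|q\|}{2\kappa\mu_p\|c\|},\qquad \sigma=\frac{\mu_p\|c\|}{2\mu_d\|q\|\lambda_{\max}\lambda_{\min}},$$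 and let $\varepsilon>0$. Then an outer iterate with $\mathcal E_d(x^{N,0},s^{N,0})\le\varepsilon$ is reached after finitely many PDHG steps, and the total number $T$ of PDHG steps (over all inner loops) that are run until the first such iterate is obtained satisfies $$T\le\max\Big\{0,\ 5e\,\widehat{\mathcal N}\,\ln\Big(8e\,\widehat{\mathcal N}\cdot\frac{\mathcal E_d(x^{0,0},s^{0,0})}{\varepsilon}\Big(1+\kappa\frac{\mu_p\|c\|}{\mu_d\|q\|}\Big)\Big(1+\frac{\mu_d\|q\|}{\mu_p\|c\|}\Big)\Big)+1\Big\},$$ where $$\widehat{\mathcal N}:=16\kappa\left(\frac{\theta_p^\star}{\mu_p}+\frac{\theta_d^\star}{\mu_d}+\frac{\operatorname{Dist}(0,X^\star)}{\mu_d\operatorname{Dist}(0,V_p)}+\frac{\operatorname{Dist}(c,S^\star)}{\mu_p\operatorname{Dist}(0,V_d)}\right).$$ -/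

import Mathlib

open Filter Topology
open scoped Matrix

/-- `ℝⁿ` with its Euclidean norm and inner product. -/
abbrev Vec (n : ℕ) : Type := EuclideanSpace ℝ (Fin n)

/-- `G` is the Moore–Penrose inverse of the real matrix `S` (the four Penrose conditions). -/
structure IsMoorePenrose {m n : ℕ} (S : Matrix (Fin m) (Fin n) ℝ)
    (G : Matrix (Fin n) (Fin m) ℝ) : Prop where
  mul_mul_left : S * G * S = S
  mul_mul_right : G * S * G = G
  symm_left : (S * G)ᵀ = S * G
  symm_right : (G * S)ᵀ = G * S

/-- The Moore–Penrose inverse is unique. -/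
theorem IsMoorePenrose.unique {m n : ℕ} {S : Matrix (Fin m) (Fin n) ℝ}
    {G H : Matrix (Fin n) (Fin m) ℝ} (hG : IsMoorePenrose S G) (hH : IsMoorePenrose S H) :
    G = H := by
  have h1 : S * G = S * H := by
    calc S * G = (S * G)ᵀ := hG.symm_left.symm
      _ = ((S * H) * (S * G))ᵀ := by
        rw [← Matrix.mul_assoc, hH.mul_mul_left]
      _ = (S * G)ᵀ * (S * H)ᵀ := Matrix.transpose_mul _ _
      _ = (S * G) * (S * H) := by rw [hG.symm_left, hH.symm_left]
      _ = S * H := by rw [← Matrix.mul_assoc, hG.mul_mul_left]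
  have h2 : G * S = H * S := by
    calc G * S = (G * S)ᵀ := hG.symm_right.symm
      _ = ((G * S) * (H * S))ᵀ := by
        rw [Matrix.mul_assoc G S, ← Matrix.mul_assoc S H S, hH.mul_mul_left]
      _ = (H * S)ᵀ * (G * S)ᵀ := Matrix.transpose_mul _ _
      _ = (H * S) * (G * S) := by rw [hG.symm_right, hH.symm_right]
      _ = H * S := by rw [Matrix.mul_assoc H S, ← Matrix.mul_assoc S G S, hG.mul_mul_left]
  calc G = G * S * G := hG.mul_mul_right.symm
    _ = H * (S * G) := by rw [h2, Matrix.mul_assoc]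
    _ = H * S * H := by rw [h1, ← Matrix.mul_assoc]
    _ = H := hH.mul_mul_right

/-- Symmetric real matrices have a Moore–Penrose inverse. -/
theorem exists_isMoorePenrose {m : ℕ} (S : Matrix (Fin m) (Fin m) ℝ) (hS : S.IsHermitian) :
    ∃ G, IsMoorePenrose S G := by
  set U : Matrix (Fin m) (Fin m) ℝ := (hS.eigenvectorUnitary : Matrix (Fin m) (Fin m) ℝ) with hU
  set D : Matrix (Fin m) (Fin m) ℝ := Matrix.diagonal hS.eigenvalues with hD
  set E : Matrix (Fin m) (Fin m) ℝ := Matrix.diagonal (fun i => (hS.eigenvalues i)⁻¹) with hE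
  have hUU : Uᵀ * U = 1 := by
    have h := Unitary.coe_star_mul_self hS.eigenvectorUnitary
    rwa [Matrix.star_eq_conjTranspose, Matrix.conjTranspose_eq_transpose_of_trivial] at h
  have hSU : S = U * D * Uᵀ := by
    have h := hS.spectral_theorem
    rw [Unitary.conjStarAlgAut_apply, Matrix.star_eq_conjTranspose,
      Matrix.conjTranspose_eq_transpose_of_trivial] at h
    exact h
  have key : ∀ X Y : Matrix (Fin m) (Fin m) ℝ,
      (U * X * Uᵀ) * (U * Y * Uᵀ) = U * (X * Y) * Uᵀ := by
    intro X Y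
    calc (U * X * Uᵀ) * (U * Y * Uᵀ) = U * X * (Uᵀ * U) * Y * Uᵀ := by
          simp only [Matrix.mul_assoc]
      _ = U * (X * Y) * Uᵀ := by rw [hUU]; simp only [Matrix.mul_one, Matrix.mul_assoc]
  have hDE : (D * E)ᵀ = D * E := by
    simp [hD, hE, Matrix.diagonal_mul_diagonal, Matrix.diagonal_transpose]
  have hED : (E * D)ᵀ = E * D := by
    simp [hD, hE, Matrix.diagonal_mul_diagonal, Matrix.diagonal_transpose]
  refine ⟨U * E * Uᵀ, ?_, ?_, ?_, ?_⟩
  · rw [hSU, key, key]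
    congr 2
    simp only [hD, hE, Matrix.diagonal_mul_diagonal]
    congr 1; funext i; exact mul_inv_mul_cancel _
  · rw [hSU, key, key]
    congr 2
    simp only [hD, hE, Matrix.diagonal_mul_diagonal]
    congr 1; funext i
    simpa using mul_inv_mul_cancel (hS.eigenvalues i)⁻¹
  · rw [hSU, key, Matrix.transpose_mul, Matrix.transpose_mul, hDE, Matrix.transpose_transpose,
      Matrix.mul_assoc U]
  · rw [hSU, key, Matrix.transpose_mul, Matrix.transpose_mul, hED, Matrix.transpose_transpose,
      Matrix.mul_assoc U]

/-- `A Aᵀ` is symmetric. -/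
theorem isHermitian_mul_transpose {m n : ℕ} (A : Matrix (Fin m) (Fin n) ℝ) :
    (A * Aᵀ).IsHermitian := by
  rw [← Matrix.conjTranspose_eq_transpose_of_trivial]
  exact Matrix.isHermitian_mul_conjTranspose_self A

/-- `(A Aᵀ)†`, the Moore–Penrose inverse of `A Aᵀ`. -/
noncomputable def gramPinv {m n : ℕ} (A : Matrix (Fin m) (Fin n) ℝ) :
    Matrix (Fin m) (Fin m) ℝ :=
  (exists_isMoorePenrose (A * Aᵀ) (isHermitian_mul_transpose A)).choose

/-- The defining property of `gramPinv`. -/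
theorem gramPinv_spec {m n : ℕ} (A : Matrix (Fin m) (Fin n) ℝ) :
    IsMoorePenrose (A * Aᵀ) (gramPinv A) :=
  (exists_isMoorePenrose (A * Aᵀ) (isHermitian_mul_transpose A)).choose_spec

/-- The nonnegative orthant `ℝⁿ₊`. -/
def orthant (n : ℕ) : Set (Vec n) := {x | ∀ i, 0 ≤ x i}

/-- The error ratio `θ(u)` of `F = V ∩ ℝⁿ₊` at a point `u` of the affine subspace `V`:
`Dist(u, F) / Dist(u, ℝⁿ₊)` for `u ∉ F`, and `1` for `u ∈ F`. -/
noncomputable def errorRatio {n : ℕ} (V : Set (Vec n)) (u : Vec n) : ℝ :=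
  open Classical in
  if u ∈ V ∩ orthant n then 1
  else Metric.infDist u (V ∩ orthant n) / Metric.infDist u (orthant n)

/-- The limiting error ratio: the limit, as `ε ↓ 0`, of the supremum of the error ratio over the
points of `V` at distance at most `ε` from the optimal set `U`. -/
noncomputable def limitingER {n : ℕ} (V U : Set (Vec n)) : ℝ :=
  limUnder (𝓝[>] (0 : ℝ)) fun ε : ℝ => sSup (errorRatio V '' {u | u ∈ V ∧ Metric.infDist u U ≤ ε})

/-- The LP sharpness: the infimum over `u ∈ F \ U` of `Dist(u, V ∩ H) / Dist(u, U)`, with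
`F = V ∩ ℝⁿ₊` the feasible set, `U` the optimal set and `H` the optimal objective hyperplane. -/
noncomputable def sharpness {n : ℕ} (V H U : Set (Vec n)) : ℝ :=
  sInf ((fun u => Metric.infDist u (V ∩ H) / Metric.infDist u U) '' ((V ∩ orthant n) \ U))

/-- The data of the standard form linear program `min cᵀx` subject to `A x = b`, `x ≥ 0`. -/
structure LPData (m n : ℕ) where
  A : Matrix (Fin m) (Fin n) ℝ
  b : Vec m
  c : Vec n

namespace LPData

/-- `x ↦ A x`. -/
noncomputable def mulA {m n : ℕ} (P : LPData m n) : Vec n →ₗ[ℝ] Vec m :=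
  Matrix.toEuclideanLin P.A

/-- `y ↦ Aᵀ y`. -/
noncomputable def mulAT {m n : ℕ} (P : LPData m n) : Vec m →ₗ[ℝ] Vec n :=
  Matrix.toEuclideanLin P.Aᵀ

/-- `q = Aᵀ (A Aᵀ)† b`. -/
noncomputable def q {m n : ℕ} (P : LPData m n) : Vec n :=
  P.mulAT (Matrix.toEuclideanLin (gramPinv P.A) P.b)

/-- `V_p = {x : A x = b}`. -/
def Vp {m n : ℕ} (P : LPData m n) : Set (Vec n) := {x | P.mulA x = P.b}

/-- `V_d = c + Im(Aᵀ)`. -/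
def Vd {m n : ℕ} (P : LPData m n) : Set (Vec n) := {s | ∃ y : Vec m, s = P.c + P.mulAT y}

/-- The primal feasible set. -/
def Fp {m n : ℕ} (P : LPData m n) : Set (Vec n) := P.Vp ∩ orthant n

/-- The set of feasible dual slacks. -/
def Fd {m n : ℕ} (P : LPData m n) : Set (Vec n) := P.Vd ∩ orthant n

/-- The primal optimal set `X* = argmin {cᵀx : x ∈ F_p}`. -/
def Xstar {m n : ℕ} (P : LPData m n) : Set (Vec n) :=
  {x | x ∈ P.Fp ∧ ∀ x' ∈ P.Fp, inner ℝ P.c x ≤ inner ℝ P.c x'}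

/-- The set of optimal dual slacks `S* = argmax {qᵀ(c - s) : s ∈ F_d}`. -/
def Sstar {m n : ℕ} (P : LPData m n) : Set (Vec n) :=
  {s | s ∈ P.Fd ∧ ∀ s' ∈ P.Fd, inner ℝ P.q (P.c - s') ≤ inner ℝ P.q (P.c - s)}

/-- The standing assumption: the primal problem has an optimal solution, and both problems have
feasible solutions that are not optimal. -/
structure Assumption {m n : ℕ} (P : LPData m n) : Prop where
  exists_optimal : P.Xstar.Nonempty
  exists_nonoptimal_primal : (P.Fp \ P.Xstar).Nonempty
  exists_nonoptimal_dual : (P.Fd \ P.Sstar).Nonempty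

/-- The primal optimal objective hyperplane. -/
def Hp {m n : ℕ} (P : LPData m n) : Set (Vec n) :=
  {x | ∃ xs ∈ P.Xstar, inner ℝ P.c x = inner ℝ P.c xs}

/-- The dual optimal objective hyperplane. -/
def Hd {m n : ℕ} (P : LPData m n) : Set (Vec n) :=
  {s | ∃ ss ∈ P.Sstar, inner ℝ P.q (P.c - s) = inner ℝ P.q (P.c - ss)}

/-- The primal limiting error ratio `θ_p*`. -/
noncomputable def thetap {m n : ℕ} (P : LPData m n) : ℝ := limitingER P.Vp P.Xstar

/-- The dual limiting error ratio `θ_d*`. -/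
noncomputable def thetad {m n : ℕ} (P : LPData m n) : ℝ := limitingER P.Vd P.Sstar

/-- The primal LP sharpness `μ_p`. -/
noncomputable def mup {m n : ℕ} (P : LPData m n) : ℝ := sharpness P.Vp P.Hp P.Xstar

/-- The dual LP sharpness `μ_d`. -/
noncomputable def mud {m n : ℕ} (P : LPData m n) : ℝ := sharpness P.Vd P.Hd P.Sstar

/-- The positive singular values of `A`. -/
def posSingularValues {m n : ℕ} (P : LPData m n) : Set ℝ :=
  {s | 0 < s ∧ ∃ i : ℕ, P.mulA.singularValues i = s}

/-- The largest positive singular value of `A`. -/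
noncomputable def lammax {m n : ℕ} (P : LPData m n) : ℝ := sSup P.posSingularValues

/-- The smallest positive singular value of `A`. -/
noncomputable def lammin {m n : ℕ} (P : LPData m n) : ℝ := sInf P.posSingularValues

/-- The condition number of `A`. -/
noncomputable def kappa {m n : ℕ} (P : LPData m n) : ℝ := P.lammax / P.lammin

/-- The Lagrangian `L(x, y) = cᵀx + bᵀy - xᵀAᵀy`. -/
noncomputable def lagrangian {m n : ℕ} (P : LPData m n) (x : Vec n) (y : Vec m) : ℝ :=
  inner ℝ P.c x + inner ℝ P.b y - inner ℝ x (P.mulAT y)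

/-- One PDHG step with step-sizes `τ`, `σ` at `z = (x, y)`:
`x⁺ = P_{ℝⁿ₊}(x - τ (c - Aᵀy))` (componentwise positive part) and
`y⁺ = y + σ (b - A (2 x⁺ - x))`. -/
noncomputable def pdhgStep {m n : ℕ} (P : LPData m n) (τ σ : ℝ) (z : Vec n × Vec m) :
    Vec n × Vec m :=
  let xp : Vec n := WithLp.toLp 2 fun i => max 0 ((z.1 - τ • (P.c - P.mulAT z.2)) i)
  (xp, z.2 + σ • (P.b - P.mulA ((2 : ℝ) • xp - z.1)))

/-- `‖z‖_M = √(zᵀ M z)` for `M = [[I/τ, Aᵀ], [A, I/σ]]`, that is,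
`‖(x, y)‖_M² = ‖x‖²/τ + 2 yᵀAx + ‖y‖²/σ`. This is the matrix in which `pdhgStep` is a
proximal-point step: `M (z - z⁺)` is a subgradient at `z⁺` of the saddle function `L`. -/
noncomputable def normM {m n : ℕ} (P : LPData m n) (τ σ : ℝ) (z : Vec n × Vec m) : ℝ :=
  Real.sqrt (‖z.1‖ ^ 2 / τ + 2 * inner ℝ z.2 (P.mulA z.1) + ‖z.2‖ ^ 2 / σ)

/-- The normalized duality gap
`ρ(r; z) = (1/r) max {L(x, ŷ) - L(x̂, y) : x̂ ≥ 0, ‖ẑ - z‖_M ≤ r}` (used for `r > 0`). -/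
noncomputable def rho {m n : ℕ} (P : LPData m n) (τ σ : ℝ) (r : ℝ) (z : Vec n × Vec m) : ℝ :=
  (1 / r) * sSup ((fun w : Vec n × Vec m => P.lagrangian z.1 w.2 - P.lagrangian w.1 z.2) ''
    {w | w.1 ∈ orthant n ∧ P.normM τ σ (w - z) ≤ r})

/-- The distance to optima `E_d(x, s) = max {Dist(x, X*), Dist(s, S*)}`, with `s = c - Aᵀy`. -/
noncomputable def errD {m n : ℕ} (P : LPData m n) (z : Vec n × Vec m) : ℝ :=
  max (Metric.infDist z.1 P.Xstar) (Metric.infDist (P.c - P.mulAT z.2) P.Sstar)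

end LPData

/-- The memory of restarted PDHG between two PDHG steps. -/
structure RState (m n : ℕ) where
  /-- the outer counter, the first index in `z^{outer, inner}` -/
  outer : ℕ
  /-- the inner counter, the number of PDHG steps since the last restart -/
  inner : ℕ
  /-- `z^{outer - 1, 0}` (irrelevant when `outer = 0`) -/
  prev : Vec n × Vec m
  /-- `z^{outer, 0}` -/
  start : Vec n × Vec m
  /-- `z^{outer, inner}` -/
  cur : Vec n × Vec m
  /-- the sum of `z^{outer, i}` over `1 ≤ i ≤ inner` -/
  sum : Vec n × Vec m

namespace LPData

/-- The `β`-restart condition, for outer counter `N`, inner counter `k`, `prev = z^{N-1,0}`,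
`start = z^{N,0}` and the inner average `avg`. -/
def RestartCond {m n : ℕ} (P : LPData m n) (τ σ β : ℝ) (N k : ℕ)
    (prev start avg : Vec n × Vec m) : Prop :=
  (N = 0 ∧ k = 1) ∨
  (1 ≤ N ∧ P.rho τ σ (P.normM τ σ (avg - start)) avg ≤
    β * P.rho τ σ (P.normM τ σ (start - prev)) start)

/-- One PDHG step of restarted PDHG, followed by a restart from the average of the inner iterates
when the restart condition holds. -/
noncomputable def advance {m n : ℕ} (P : LPData m n) (τ σ β : ℝ) (S : RState m n) : RState m n :=
  let z := P.pdhgStep τ σ S.cur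
  let k := S.inner + 1
  let sum := S.sum + z
  let avg := (1 / (k : ℝ)) • sum
  open Classical in
  if P.RestartCond τ σ β S.outer k S.prev S.start avg then
    { outer := S.outer + 1, inner := 0, prev := S.start, start := avg, cur := avg, sum := 0 }
  else
    { outer := S.outer, inner := k, prev := S.prev, start := S.start, cur := z, sum := sum }

/-- The state of restarted PDHG, started from `z^{0,0} = (0, 0)`, after `t` PDHG steps. -/
noncomputable def state {m n : ℕ} (P : LPData m n) (τ σ β : ℝ) (t : ℕ) : RState m n :=
  (P.advance τ σ β)^[t] { outer := 0, inner := 0, prev := 0, start := 0, cur := 0, sum := 0 }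

/-- After exactly `t` PDHG steps some outer iterate `z^{N,0}` has just become available, and it
satisfies `E_d(x^{N,0}, s^{N,0}) ≤ ε`. -/
def ReachesAt {m n : ℕ} (P : LPData m n) (τ σ β ε : ℝ) (t : ℕ) : Prop :=
  (P.state τ σ β t).inner = 0 ∧ P.errD (P.state τ σ β t).start ≤ ε

/-- `N̂ = 16 κ (θ_p*/μ_p + θ_d*/μ_d + Dist(0, X*)/(μ_d Dist(0, V_p))
+ Dist(c, S*)/(μ_p Dist(0, V_d)))`. -/
noncomputable def Nhat {m n : ℕ} (P : LPData m n) : ℝ :=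
  16 * P.kappa * (P.thetap / P.mup + P.thetad / P.mud
    + Metric.infDist 0 P.Xstar / (P.mud * Metric.infDist 0 P.Vp)
    + Metric.infDist P.c P.Sstar / (P.mup * Metric.infDist 0 P.Vd))

end LPData

/-!
The proof has a geometric half and an algorithmic half.

*Geometry.* The primal and the dual program have the same form: minimize a linear function `⟪g, ·⟫`
over the nonnegative points of an affine subspace with direction `W`, where `g ∈ W`; the primal has
direction `ker A` and objective `c` (this is where `A c = 0` enters), the dual has the orthogonal
complement and objective `q`. Hoffman's error bound (`exists_hoffman_bound`, from Farkas' lemma)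
makes the sharpness positive and the error ratio bounded, so that the limiting error ratio is a true
limit. Moving a point of the affine subspace towards a nearest optimal point shrinks its distance to
the orthant at least as fast as its distance to the optimal set, so the *limiting* error ratio `θ`
controls points far from optimality as well (`sharpness_mul_infDist_optSet_le`):
`μ Dist(u, U) ≤ (1 + μ) θ Dist(u, ℝⁿ₊) + (objective gap) / ‖g‖`. Strong duality
(`exists_dual_certificate`) provides dual optimal slacks, and complementary slackness makes every
primal-dual optimal pair a saddle point.

*Algorithm.* A PDHG step is a proximal-point step in the norm `‖·‖_M` (`gap_pdhgStep_le`). Hence the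
iterates do not move away from saddle points, and the normalized duality gap `ρ` of the average of
`j` steps is at most `4 / j` times the `M`-distance from the starting point to a saddle point
(`IsAverage.rho_le`). Conversely, a bound on `ρ` bounds the primal residual, the negative part of
the dual slack and the duality gap; the two objective gaps add up to the duality gap, and with the
given step-sizes they enter the weighted distance to optimality with equal coefficients. So that
distance is at most a condition number times `ρ` (`weightedDist_le_of_gap_le`). Combining the two,
an inner loop ends after a number of steps proportional to `N̂`, each restart divides `ρ` by at
least `e`, and the distance to optimality after a given number of outer loops is bounded
geometrically (`Invariant`).
-/

/-! ### Finitely generated cones, Farkas' lemma and Hoffman's bound -/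

section Polyhedra

variable {E : Type*} [NormedAddCommGroup E] [InnerProductSpace ℝ E]

/-- Carathéodory step: a conic combination of linearly dependent vectors can drop a generator. -/
theorem exists_conic_erase {ι : Type*} [DecidableEq ι] (a : ι → E) (s : Finset ι)
    (hdep : ¬ LinearIndepOn ℝ a (s : Set ι)) (l : ι → ℝ) (hl : ∀ i, 0 ≤ l i) :
    ∃ j ∈ s, ∃ l' : ι → ℝ, (∀ i, 0 ≤ l' i) ∧
      ∑ i ∈ s.erase j, l' i • a i = ∑ i ∈ s, l i • a i := by
  rw [linearIndepOn_finset_iff] at hdep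
  push Not at hdep
  obtain ⟨f, hf, j0, hj0, hfj0⟩ := hdep
  -- after a change of sign some coefficient is positive
  obtain ⟨f, hf, j0, hj0, hfj0⟩ : ∃ f : ι → ℝ, ∑ i ∈ s, f i • a i = 0 ∧ ∃ j ∈ s, 0 < f j := by
    rcases lt_or_gt_of_ne hfj0 with h | h
    · exact ⟨fun i => - f i, by simp [hf], j0, hj0, by simpa using h⟩
    · exact ⟨f, hf, j0, hj0, h⟩
  obtain ⟨j, hj, hmin⟩ := Finset.exists_min_image (s.filter fun i => 0 < f i)
    (fun i => l i / f i) ⟨j0, by simp [hj0, hfj0]⟩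
  rw [Finset.mem_filter] at hj
  set t := l j / f j with ht
  have ht0 : 0 ≤ t := div_nonneg (hl j) hj.2.le
  refine ⟨j, hj.1, fun i => if i ∈ s then l i - t * f i else 0, fun i => ?_, ?_⟩
  · simp only
    split_ifs with hi
    · rcases le_or_gt (f i) 0 with h | h
      · nlinarith [hl i]
      · have := hmin i (by simp [hi, h])
        rw [le_div_iff₀ h] at this
        linarith
    · exact le_rfl
  · have hjz : (if j ∈ s then l j - t * f j else 0) = 0 := by
      rw [if_pos hj.1, ht, div_mul_cancel₀ _ hj.2.ne']; ring
    have h1 : ∑ i ∈ s.erase j, (if i ∈ s then l i - t * f i else 0) • a i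
        = ∑ i ∈ s, (if i ∈ s then l i - t * f i else 0) • a i := by
      rw [← Finset.add_sum_erase _ _ hj.1, hjz]; simp
    rw [h1]
    have h2 : ∀ i ∈ s, (if i ∈ s then l i - t * f i else 0) • a i
        = l i • a i - t • (f i • a i) := by
      intro i hi
      rw [if_pos hi, sub_smul, smul_smul]
    rw [Finset.sum_congr rfl h2, Finset.sum_sub_distrib, ← Finset.smul_sum, hf]
    simp

/-- Points of a finitely generated cone are conic combinations of the generators whose coefficients
are bounded by a fixed multiple of the norm. -/
theorem exists_bounded_conic_repr {ι : Type*} (a : ι → E) (s : Finset ι) :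
    ∃ C : ℝ, 0 ≤ C ∧ ∀ l : ι → ℝ, (∀ i, 0 ≤ l i) →
      ∃ l' : ι → ℝ, (∀ i, 0 ≤ l' i) ∧ ∑ i ∈ s, l' i • a i = ∑ i ∈ s, l i • a i ∧
        ∑ i ∈ s, l' i ≤ C * ‖∑ i ∈ s, l i • a i‖ := by
  classical
  induction s using Finset.strongInduction with
  | H s ih =>
    by_cases hdep : LinearIndepOn ℝ a (s : Set ι)
    · -- independent generators: the coefficient map is a linear homeomorphism onto its image
      have hinj : LinearMap.ker (Fintype.linearCombination ℝ (fun i : s => a i)) = ⊥ := by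
        have : LinearIndependent ℝ (fun i : s => a i) := hdep
        exact LinearMap.ker_eq_bot.2 this.fintypeLinearCombination_injective
      obtain ⟨K, hK, hKl⟩ := (Fintype.linearCombination ℝ
        (fun i : s => a i)).exists_antilipschitzWith hinj
      refine ⟨s.card * K, by positivity, fun l hl => ⟨l, hl, rfl, ?_⟩⟩
      have h1 := hKl.le_mul_norm (map_zero _) (fun i : s => l i)
      have h2 : Fintype.linearCombination ℝ (fun i : s => a i) (fun i : s => l i)
          = ∑ i ∈ s, l i • a i := by
        rw [Fintype.linearCombination_apply, ← Finset.sum_coe_sort s (fun i => l i • a i)]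
      rw [h2] at h1
      calc ∑ i ∈ s, l i ≤ ∑ _i ∈ s, K * ‖∑ i ∈ s, l i • a i‖ := by
            refine Finset.sum_le_sum fun i hi => ?_
            refine le_trans ?_ h1
            refine le_trans (le_abs_self _) ?_
            exact norm_le_pi_norm (fun i : s => l i) ⟨i, hi⟩
        _ = s.card * K * ‖∑ i ∈ s, l i • a i‖ := by
            rw [Finset.sum_const, nsmul_eq_mul, mul_assoc]
    · -- dependent generators: some generator is dropped, and finitely many constants are summed
      have hch : ∀ j ∈ s, ∃ C : ℝ, 0 ≤ C ∧ ∀ l : ι → ℝ, (∀ i, 0 ≤ l i) →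
          ∃ l' : ι → ℝ, (∀ i, 0 ≤ l' i) ∧
            ∑ i ∈ s.erase j, l' i • a i = ∑ i ∈ s.erase j, l i • a i ∧
            ∑ i ∈ s.erase j, l' i ≤ C * ‖∑ i ∈ s.erase j, l i • a i‖ :=
        fun j hj => ih _ (Finset.erase_ssubset hj)
      choose! C hC0 hC using hch
      refine ⟨∑ j ∈ s, C j, Finset.sum_nonneg hC0, fun l hl => ?_⟩
      obtain ⟨j, hj, l1, hl1, he1⟩ := exists_conic_erase a s hdep l hl
      obtain ⟨l2, hl2, he2, hb2⟩ := hC j hj l1 hl1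
      refine ⟨fun i => if i = j then 0 else l2 i, fun i => ?_, ?_, ?_⟩
      · simp only; split_ifs
        · exact le_rfl
        · exact hl2 i
      · rw [← Finset.add_sum_erase _ _ hj]
        simp only [if_true, zero_smul, zero_add]
        rw [← he1, ← he2]
        refine Finset.sum_congr rfl fun i hi => ?_
        rw [if_neg (Finset.ne_of_mem_erase hi)]
      · rw [← Finset.add_sum_erase _ _ hj, if_pos rfl, zero_add]
        calc ∑ i ∈ s.erase j, (if i = j then 0 else l2 i) = ∑ i ∈ s.erase j, l2 i := by
              refine Finset.sum_congr rfl fun i hi => ?_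
              rw [if_neg (Finset.ne_of_mem_erase hi)]
          _ ≤ C j * ‖∑ i ∈ s, l i • a i‖ := by rw [← he1]; exact hb2
          _ ≤ (∑ j ∈ s, C j) * ‖∑ i ∈ s, l i • a i‖ := by
              gcongr
              exact Finset.single_le_sum (f := C) hC0 hj

/-- The cone generated by finitely many vectors. -/
def conicHull {ι : Type*} (a : ι → E) (s : Finset ι) : Set E :=
  {g | ∃ l : ι → ℝ, (∀ i, 0 ≤ l i) ∧ ∑ i ∈ s, l i • a i = g}

theorem convex_conicHull {ι : Type*} (a : ι → E) (s : Finset ι) : Convex ℝ (conicHull a s) := by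
  rintro _ ⟨l, hl, rfl⟩ _ ⟨k, hk, rfl⟩ t u ht hu -
  refine ⟨fun i => t * l i + u * k i, fun i => ?_, ?_⟩
  · have := hl i; have := hk i; positivity
  · simp only [add_smul, Finset.sum_add_distrib, Finset.smul_sum, smul_smul]

/-- Finitely generated cones are closed, as bounded coefficients have convergent subsequences. -/
theorem isClosed_conicHull {ι : Type*} [Finite ι] (a : ι → E) (s : Finset ι) :
    IsClosed (conicHull a s) := by
  obtain ⟨C, hC0, hC⟩ := exists_bounded_conic_repr a s
  classical
  have := Fintype.ofFinite ι
  refine isClosed_of_closure_subset fun g hg => ?_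
  -- near `g` the cone coincides with the image of a compact box of coefficients
  set B : Set (ι → ℝ) := Set.Icc 0 (fun _ => C * (‖g‖ + 1)) with hB
  have hcomp : IsCompact ((fun l : ι → ℝ => ∑ i ∈ s, l i • a i) '' B) :=
    isCompact_Icc.image (by fun_prop)
  have hsub : conicHull a s ∩ Metric.ball g 1 ⊆ (fun l : ι → ℝ => ∑ i ∈ s, l i • a i) '' B := by
    rintro _ ⟨⟨l, hl, rfl⟩, hball⟩
    obtain ⟨l', hl', he, hb⟩ := hC l hl
    refine ⟨fun i => if i ∈ s then l' i else 0, ⟨fun i => ?_, fun i => ?_⟩, ?_⟩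
    · simp only; split_ifs
      · exact hl' i
      · exact le_rfl
    · simp only
      have hn : ‖∑ i ∈ s, l i • a i‖ ≤ ‖g‖ + 1 := by
        have h := norm_sub_norm_le (∑ i ∈ s, l i • a i) g
        rw [Metric.mem_ball, dist_eq_norm] at hball
        linarith
      split_ifs with hi
      · calc l' i ≤ ∑ i ∈ s, l' i := Finset.single_le_sum (fun i _ => hl' i) hi
          _ ≤ C * ‖∑ i ∈ s, l i • a i‖ := hb
          _ ≤ _ := by gcongr
      · positivity
    · rw [← he]
      refine Finset.sum_congr rfl fun i hi => ?_
      simp only [if_pos hi]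
  have hg' : g ∈ closure (conicHull a s ∩ Metric.ball g 1) := by
    rw [mem_closure_iff_nhds] at hg ⊢
    intro t ht
    obtain ⟨y, hy1, hy2⟩ := hg (t ∩ Metric.ball g 1)
      (Filter.inter_mem ht (Metric.ball_mem_nhds g one_pos))
    exact ⟨y, hy1.1, hy2, hy1.2⟩
  obtain ⟨l, hl, he⟩ := hcomp.isClosed.closure_subset_iff.2 hsub hg'
  exact ⟨l, fun i => hl.1 i, he⟩

/-- Existence of a nearest point, with its variational characterization. -/
theorem exists_nearest [FiniteDimensional ℝ E] {K : Set E} (hne : K.Nonempty) (hcl : IsClosed K)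
    (hconv : Convex ℝ K) (u : E) : ∃ p ∈ K, ∀ w ∈ K, inner ℝ (u - p) (w - p) ≤ 0 := by
  have := FiniteDimensional.complete ℝ E
  obtain ⟨p, hp, h⟩ := exists_norm_eq_iInf_of_complete_convex hne hcl.isComplete hconv u
  exact ⟨p, hp, (norm_eq_iInf_iff_real_inner_le_zero hconv hp).1 h⟩

/-- **Farkas' lemma** for finitely many generators. -/
theorem mem_conicHull_of_forall_inner_nonneg [FiniteDimensional ℝ E] {ι : Type*} [Finite ι]
    (a : ι → E) (s : Finset ι) (g : E)
    (h : ∀ d : E, (∀ i ∈ s, 0 ≤ inner ℝ (a i) d) → 0 ≤ inner ℝ g d) : g ∈ conicHull a s := by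
  classical
  obtain ⟨p, hp, hproj⟩ := exists_nearest (K := conicHull a s)
    ⟨0, fun _ => 0, fun _ => le_rfl, by simp⟩ (isClosed_conicHull a s) (convex_conicHull a s) g
  obtain ⟨l, hl, rfl⟩ := hp
  set p := ∑ i ∈ s, l i • a i with hp
  have hscale : ∀ t : ℝ, 0 ≤ t → t • p ∈ conicHull a s := fun t ht =>
    ⟨fun i => t * l i, fun i => mul_nonneg ht (hl i), by
      rw [hp, Finset.smul_sum]; simp only [smul_smul]⟩
  have horth : inner ℝ (g - p) p = 0 := by
    have h0 := hproj _ (hscale 0 le_rfl)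
    have h2 := hproj _ (hscale 2 (by norm_num))
    rw [zero_smul, zero_sub, inner_neg_right] at h0
    rw [two_smul, add_sub_cancel_right] at h2
    linarith
  have hd := h (p - g) (fun i hi => by
    have hmem : p + a i ∈ conicHull a s := by
      refine ⟨fun j => l j + if j = i then 1 else 0, fun j => ?_, ?_⟩
      · have := hl j; positivity
      · simp [add_smul, Finset.sum_add_distrib, ite_smul, hi, hp]
    have := hproj _ hmem
    rw [add_sub_cancel_left, real_inner_comm] at this
    rw [← neg_sub, inner_neg_right]; linarith)
  have hz : inner ℝ (g - p) (g - p) ≤ (0 : ℝ) := by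
    have e1 : inner ℝ (g - p) (g - p) = inner ℝ (g - p) g - (inner ℝ (g - p) p : ℝ) :=
      inner_sub_right _ _ _
    have e2 : inner ℝ g (p - g) = -(inner ℝ (g - p) g : ℝ) := by
      rw [← neg_sub g p, inner_neg_right, real_inner_comm]
    linarith
  have : g - p = 0 := real_inner_self_nonpos.1 hz
  exact ⟨l, hl, (sub_eq_zero.1 this).symm⟩

/-- **Hoffman's error bound**: the distance to a polyhedron is at most a constant times the total
violation of its inequalities. -/
theorem exists_hoffman_bound [FiniteDimensional ℝ E] {ι : Type*} [Fintype ι] (a : ι → E)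
    (β : ι → ℝ) (hne : {x : E | ∀ i, inner ℝ (a i) x ≤ β i}.Nonempty) :
    ∃ C : ℝ, 0 ≤ C ∧ ∀ x : E, ∃ p : E, (∀ i, inner ℝ (a i) p ≤ β i) ∧
      ‖x - p‖ ≤ C * ∑ i, max 0 (inner ℝ (a i) x - β i) := by
  classical
  choose C hC0 hC using exists_bounded_conic_repr a
  refine ⟨∑ s : Finset ι, C s, Finset.sum_nonneg fun s _ => hC0 s, fun x => ?_⟩
  have hcl : IsClosed {x : E | ∀ i, inner ℝ (a i) x ≤ β i} := by
    simp only [Set.ofPred_forall]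
    exact isClosed_iInter fun i => isClosed_le (by fun_prop) (by fun_prop)
  have hconv : Convex ℝ {x : E | ∀ i, inner ℝ (a i) x ≤ β i} := by
    intro y hy z hz t u ht hu htu i
    rw [inner_add_right, inner_smul_right, inner_smul_right]
    calc t * inner ℝ (a i) y + u * inner ℝ (a i) z ≤ t * β i + u * β i := by
          gcongr
          · exact hy i
          · exact hz i
      _ = β i := by rw [← add_mul, htu, one_mul]
  obtain ⟨p, hp, hproj⟩ := exists_nearest hne hcl hconv x
  refine ⟨p, hp, ?_⟩
  set s : Finset ι := Finset.univ.filter fun i => inner ℝ (a i) p = β i with hs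
  -- the residual is normal to the polyhedron, hence a combination of the active constraints
  have hcone : x - p ∈ conicHull a s := by
    refine mem_conicHull_of_forall_inner_nonneg a s _ fun d hd => ?_
    -- a small step along `-d` keeps the inactive constraints satisfied
    obtain ⟨t, ht, hfeas⟩ : ∃ t : ℝ, 0 < t ∧ ∀ i, inner ℝ (a i) (p - t • d) ≤ β i := by
      have hev : ∀ i, ∀ᶠ t : ℝ in 𝓝[>] 0, inner ℝ (a i) (p - t • d) ≤ β i := by
        intro i
        by_cases hi : inner ℝ (a i) p = β i
        · filter_upwards [self_mem_nhdsWithin] with t ht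
          have := hd i (by simp [hs, hi])
          rw [inner_sub_right, inner_smul_right, hi]
          have := mul_nonneg (le_of_lt ht) this
          linarith
        · have hlt : inner ℝ (a i) p < β i := lt_of_le_of_ne (hp i) hi
          have hcont : Tendsto (fun t : ℝ => (inner ℝ (a i) (p - t • d) : ℝ)) (𝓝[>] 0)
              (𝓝 (inner ℝ (a i) (p - (0 : ℝ) • d))) :=
            ((by fun_prop : Continuous fun t : ℝ =>
              (inner ℝ (a i) (p - t • d) : ℝ)).tendsto 0).mono_left nhdsWithin_le_nhds
          rw [zero_smul, sub_zero] at hcont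
          filter_upwards [hcont.eventually_lt_const hlt] with t ht using ht.le
      obtain ⟨t, h1, h2⟩ := ((Filter.eventually_all.2 hev).and self_mem_nhdsWithin).exists
      exact ⟨t, h2, h1⟩
    have := hproj _ hfeas
    rw [sub_sub_cancel_left, inner_neg_right, inner_smul_right] at this
    by_contra hneg
    push Not at hneg
    nlinarith
  obtain ⟨l, hl, he⟩ := hcone
  obtain ⟨l', hl', he', hb⟩ := hC s l hl
  rw [he] at he' hb
  set v := ∑ i, max 0 (inner ℝ (a i) x - β i) with hv
  have hv0 : 0 ≤ v := Finset.sum_nonneg fun i _ => le_max_left _ _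
  have hsq : ‖x - p‖ * ‖x - p‖ ≤ (C s * ‖x - p‖) * v := by
    calc ‖x - p‖ * ‖x - p‖ = inner ℝ (∑ i ∈ s, l' i • a i) (x - p) := by
          rw [he', real_inner_self_eq_norm_mul_norm]
      _ = ∑ i ∈ s, l' i * (inner ℝ (a i) x - β i) := by
          rw [sum_inner]
          refine Finset.sum_congr rfl fun i hi => ?_
          rw [inner_smul_left, inner_sub_right, (Finset.mem_filter.1 hi).2]
          simp
      _ ≤ ∑ i ∈ s, l' i * v := by
          refine Finset.sum_le_sum fun i _ => mul_le_mul_of_nonneg_left ?_ (hl' i)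
          exact (le_max_right 0 _).trans (Finset.single_le_sum
            (f := fun i => max 0 (inner ℝ (a i) x - β i)) (fun i _ => le_max_left _ _)
            (Finset.mem_univ i))
      _ ≤ _ := by rw [← Finset.sum_mul]; gcongr
  have hCs : C s ≤ ∑ s, C s := Finset.single_le_sum (f := C) (fun s _ => hC0 s) (Finset.mem_univ s)
  rcases (norm_nonneg (x - p)).eq_or_lt with h0 | h0
  · rw [← h0]; exact mul_nonneg ((hC0 s).trans hCs) hv0
  · have : ‖x - p‖ ≤ C s * v := by
      refine le_of_mul_le_mul_right ?_ h0
      linarith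
    exact this.trans (by gcongr)

end Polyhedra

/-! ### Error ratio and sharpness of a linear program on a slice of the orthant -/

section ConicProgram

variable {n : ℕ}

/-- The affine subspace through `v` with direction `W`. -/
def affSlice (W : Submodule ℝ (Vec n)) (v : Vec n) : Set (Vec n) := {u | u - v ∈ W}

/-- The minimizers of `⟪g, ·⟫` over the nonnegative points of `affSlice W v`. -/
def optSet (W : Submodule ℝ (Vec n)) (v g : Vec n) : Set (Vec n) :=
  {u | u ∈ affSlice W v ∩ orthant n ∧ ∀ u' ∈ affSlice W v ∩ orthant n, inner ℝ g u ≤ inner ℝ g u'}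

/-- The hyperplane of points with optimal objective value (empty if nothing is optimal). -/
def optLevel (W : Submodule ℝ (Vec n)) (v g : Vec n) : Set (Vec n) :=
  {u | ∃ us ∈ optSet W v g, inner ℝ g u = inner ℝ g us}

variable {W : Submodule ℝ (Vec n)} {v g : Vec n}

theorem isClosed_orthant : IsClosed (orthant n) := by
  have : orthant n = ⋂ i, {x : Vec n | 0 ≤ x i} := by ext; simp [orthant]
  rw [this]
  exact isClosed_iInter fun i => isClosed_le continuous_const (by fun_prop)

theorem zero_mem_orthant : (0 : Vec n) ∈ orthant n := fun i => by simp

theorem inner_nonneg_of_mem_orthant {x y : Vec n} (hx : x ∈ orthant n) (hy : y ∈ orthant n) :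
    0 ≤ inner ℝ x y := by
  rw [PiLp.inner_apply]
  exact Finset.sum_nonneg fun i _ => by
    simpa using mul_nonneg (hy i) (hx i)

theorem isClosed_feasible : IsClosed (affSlice W v ∩ orthant n) := by
  refine IsClosed.inter ?_ isClosed_orthant
  exact W.closed_of_finiteDimensional.preimage (by fun_prop : Continuous fun u : Vec n => u - v)

theorem isClosed_optSet : IsClosed (optSet W v g) := by
  have : optSet W v g = (affSlice W v ∩ orthant n) ∩
      ⋂ u' ∈ affSlice W v ∩ orthant n, {u | inner ℝ g u ≤ inner ℝ g u'} := by
    ext u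
    simp only [optSet, Set.mem_ofPred_eq, Set.mem_inter_iff, Set.mem_iInter]
  rw [this]
  exact isClosed_feasible.inter (isClosed_biInter fun u' _ =>
    isClosed_le (by fun_prop) continuous_const)

theorem convex_orthant : Convex ℝ (orthant n) := by
  intro x hx y hy a b ha hb _ i
  have := hx i; have := hy i
  simp only [PiLp.add_apply, PiLp.smul_apply, smul_eq_mul]
  positivity

/-- The coordinate functional `u ↦ u i` on `W`, as a vector of `W`. -/
noncomputable def coordVec (W : Submodule ℝ (Vec n)) (i : Fin n) : W :=
  W.orthogonalProjectionOnto (EuclideanSpace.single i 1)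

theorem inner_coordVec (i : Fin n) (w : W) : inner ℝ (coordVec W i) w = (w : Vec n) i := by
  rw [coordVec, real_inner_comm, W.inner_orthogonalProjectionOnto_eq_of_mem_left,
    EuclideanSpace.inner_single_right]
  simp

theorem max_neg_le_infDist_orthant (u : Vec n) (i : Fin n) :
    max 0 (-(u i)) ≤ Metric.infDist u (orthant n) := by
  refine max_le Metric.infDist_nonneg ((Metric.le_infDist ⟨0, zero_mem_orthant⟩).2 fun w hw => ?_)
  have h1 : ‖(u - w) i‖ ≤ ‖u - w‖ := PiLp.norm_apply_le _ _
  rw [dist_eq_norm]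
  have h2 := neg_abs_le ((u - w) i)
  rw [Real.norm_eq_abs] at h1
  have h3 := hw i
  rw [PiLp.sub_apply] at h1 h2
  linarith

/-- The error bound of the feasible set along its affine hull. -/
theorem exists_feasible_error_bound (hF : (affSlice W v ∩ orthant n).Nonempty) :
    ∃ C : ℝ, 0 ≤ C ∧ ∀ u ∈ affSlice W v,
      Metric.infDist u (affSlice W v ∩ orthant n) ≤ C * Metric.infDist u (orthant n) := by
  obtain ⟨u0, hu0V, hu0⟩ := hF
  obtain ⟨C, hC0, hC⟩ := exists_hoffman_bound (fun i : Fin n => -coordVec W i) (fun i => v i)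
    ⟨⟨u0 - v, hu0V⟩, fun i => by
      rw [inner_neg_left, inner_coordVec]
      have := hu0 i
      simp only [PiLp.sub_apply]; linarith⟩
  refine ⟨C * n, by positivity, fun u hu => ?_⟩
  obtain ⟨p, hp, hpb⟩ := hC ⟨u - v, hu⟩
  have hmem : (p : Vec n) + v ∈ affSlice W v ∩ orthant n := by
    refine ⟨by simp [affSlice], fun i => ?_⟩
    have := hp i
    rw [inner_neg_left, inner_coordVec] at this
    simp only [PiLp.add_apply]; linarith
  calc Metric.infDist u (affSlice W v ∩ orthant n) ≤ dist u (p + v) :=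
        Metric.infDist_le_dist_of_mem hmem
    _ = ‖(⟨u - v, hu⟩ : W) - p‖ := by
        rw [dist_eq_norm, Submodule.coe_norm, Submodule.coe_sub]
        congr 1; simp only; abel
    _ ≤ C * ∑ i, max 0 (inner ℝ (-coordVec W i) (⟨u - v, hu⟩ : W) - v i) := hpb
    _ ≤ C * ∑ _i : Fin n, Metric.infDist u (orthant n) := by
        gcongr with i
        rw [inner_neg_left, inner_coordVec]
        refine le_trans (le_of_eq ?_) (max_neg_le_infDist_orthant u i)
        congr 1
        simp only [PiLp.sub_apply]; ring
    _ = C * n * Metric.infDist u (orthant n) := by simp [mul_assoc]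

/-- Linear growth of the objective away from the optimal set. -/
theorem exists_optSet_error_bound (hg : g ∈ W) {us : Vec n} (hus : us ∈ optSet W v g) :
    ∃ C : ℝ, 0 ≤ C ∧ ∀ u ∈ affSlice W v ∩ orthant n,
      Metric.infDist u (optSet W v g) ≤ C * (inner ℝ g u - inner ℝ g us) := by
  have hin : ∀ w : W, inner ℝ (⟨g, hg⟩ : W) w = inner ℝ g (w : Vec n) := fun w =>
    Submodule.coe_inner _ _ _
  obtain ⟨C, hC0, hC⟩ := exists_hoffman_bound
    (fun i : Option (Fin n) => i.elim (⟨g, hg⟩ : W) fun i => -coordVec W i)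
    (fun i => i.elim (inner ℝ g us - inner ℝ g v) fun i => v i)
    ⟨⟨us - v, hus.1.1⟩, by
      rintro (_ | i)
      · simp only [Option.elim, hin, inner_sub_right]; exact le_rfl
      · simp only [Option.elim, inner_neg_left, inner_coordVec]
        have := hus.1.2 i
        simp only [PiLp.sub_apply]; linarith⟩
  refine ⟨C, hC0, fun u hu => ?_⟩
  obtain ⟨p, hp, hpb⟩ := hC ⟨u - v, hu.1⟩
  have hgp : inner ℝ g ((p : Vec n) + v) ≤ inner ℝ g us := by
    have := hp none
    simp only [Option.elim, hin] at this
    rw [inner_add_right]; linarith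
  have hmemF : (p : Vec n) + v ∈ affSlice W v ∩ orthant n := by
    refine ⟨by simp [affSlice], fun i => ?_⟩
    have := hp (some i)
    simp only [Option.elim, inner_neg_left, inner_coordVec] at this
    simp only [PiLp.add_apply]; linarith
  have hmem : (p : Vec n) + v ∈ optSet W v g := ⟨hmemF, fun u' hu' => hgp.trans (hus.2 u' hu')⟩
  calc Metric.infDist u (optSet W v g) ≤ dist u (p + v) := Metric.infDist_le_dist_of_mem hmem
    _ = ‖(⟨u - v, hu.1⟩ : W) - p‖ := by
        rw [dist_eq_norm, Submodule.coe_norm, Submodule.coe_sub]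
        congr 1; simp only; abel
    _ ≤ _ := hpb
    _ = C * (inner ℝ g u - inner ℝ g us) := by
        congr 1
        rw [Fintype.sum_option]
        have h0 : ∀ i : Fin n, max 0 (inner ℝ (-coordVec W i) (⟨u - v, hu.1⟩ : W) - v i) = 0 := by
          intro i
          rw [inner_neg_left, inner_coordVec, max_eq_left]
          have := hu.2 i
          simp only [PiLp.sub_apply]; linarith
        simp only [Option.elim, h0, Finset.sum_const_zero, add_zero, hin, inner_sub_right]
        rw [max_eq_right]
        · ring
        · have := hus.2 u hu; linarith

theorem errorRatio_nonneg (V : Set (Vec n)) (u : Vec n) : 0 ≤ errorRatio V u := by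
  unfold errorRatio
  split_ifs
  · exact zero_le_one
  · exact div_nonneg Metric.infDist_nonneg Metric.infDist_nonneg

/-- The defining property of the error ratio. -/
theorem infDist_feasible_le_errorRatio_mul {u : Vec n} (hu : u ∈ affSlice W v) :
    Metric.infDist u (affSlice W v ∩ orthant n)
      ≤ errorRatio (affSlice W v) u * Metric.infDist u (orthant n) := by
  unfold errorRatio
  split_ifs with h
  · rw [Metric.infDist_zero_of_mem h, one_mul]; exact Metric.infDist_nonneg
  · have : 0 < Metric.infDist u (orthant n) :=
      (isClosed_orthant.notMem_iff_infDist_pos ⟨0, zero_mem_orthant⟩).1 fun h' => h ⟨hu, h'⟩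
    rw [div_mul_cancel₀ _ this.ne']

theorem bddAbove_errorRatio (hF : (affSlice W v ∩ orthant n).Nonempty) :
    BddAbove (errorRatio (affSlice W v) '' affSlice W v) := by
  obtain ⟨C, hC0, hC⟩ := exists_feasible_error_bound hF
  refine ⟨max 1 C, ?_⟩
  rintro _ ⟨u, hu, rfl⟩
  unfold errorRatio
  split_ifs with h
  · exact le_max_left _ _
  · exact le_max_of_le_right (div_le_of_le_mul₀ Metric.infDist_nonneg hC0 (hC u hu))

/-- The supremum whose limit as `ε ↓ 0` is the limiting error ratio. -/
noncomputable def supErrorRatio (V U : Set (Vec n)) (ε : ℝ) : ℝ :=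
  sSup (errorRatio V '' {u | u ∈ V ∧ Metric.infDist u U ≤ ε})

theorem errorRatio_le_supErrorRatio {U : Set (Vec n)} (hF : (affSlice W v ∩ orthant n).Nonempty)
    {u : Vec n} (hu : u ∈ affSlice W v) {ε : ℝ} (hε : Metric.infDist u U ≤ ε) :
    errorRatio (affSlice W v) u ≤ supErrorRatio (affSlice W v) U ε :=
  le_csSup ((bddAbove_errorRatio hF).mono (Set.image_mono fun _ h => h.1)) ⟨u, ⟨hu, hε⟩, rfl⟩

theorem one_le_supErrorRatio {us : Vec n} (hus : us ∈ optSet W v g) {ε : ℝ} (hε : 0 < ε) :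
    1 ≤ supErrorRatio (affSlice W v) (optSet W v g) ε := by
  have h := errorRatio_le_supErrorRatio (U := optSet W v g) ⟨us, hus.1⟩ hus.1.1 (ε := ε)
    (by rw [Metric.infDist_zero_of_mem hus]; exact hε.le)
  rwa [errorRatio, if_pos hus.1] at h

/-- The limit defining the limiting error ratio exists: the suprema decrease with `ε`. -/
theorem tendsto_supErrorRatio {us : Vec n} (hus : us ∈ optSet W v g) :
    Tendsto (supErrorRatio (affSlice W v) (optSet W v g)) (𝓝[>] 0)
      (𝓝 (limitingER (affSlice W v) (optSet W v g))) := by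
  refine tendsto_nhds_limUnder ⟨_, MonotoneOn.tendsto_nhdsGT ?_ ⟨1, ?_⟩⟩
  · intro ε hε ε' _ hle
    refine csSup_le_csSup ((bddAbove_errorRatio ⟨us, hus.1⟩).mono (Set.image_mono fun _ h => h.1))
      ⟨_, us, ⟨hus.1.1, ?_⟩, rfl⟩ (Set.image_mono fun u h => ⟨h.1, h.2.trans hle⟩)
    rw [Metric.infDist_zero_of_mem hus]; exact le_of_lt hε
  · rintro _ ⟨ε, hε, rfl⟩
    exact one_le_supErrorRatio hus hε

theorem one_le_limitingER {us : Vec n} (hus : us ∈ optSet W v g) :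
    1 ≤ limitingER (affSlice W v) (optSet W v g) :=
  ge_of_tendsto (tendsto_supErrorRatio hus)
    (by filter_upwards [self_mem_nhdsWithin] with ε hε using one_le_supErrorRatio hus hε)

theorem optSet_subset_optLevel : optSet W v g ⊆ affSlice W v ∩ optLevel W v g :=
  fun u hu => ⟨hu.1.1, u, hu, rfl⟩

theorem inner_eq_of_mem_optSet {u u' : Vec n} (hu : u ∈ optSet W v g) (hu' : u' ∈ optSet W v g) :
    (inner ℝ g u : ℝ) = inner ℝ g u' :=
  le_antisymm (hu.2 u' hu'.1) (hu'.2 u hu.1)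

theorem bddBelow_sharpness (V H U : Set (Vec n)) : BddBelow
    ((fun u => Metric.infDist u (V ∩ H) / Metric.infDist u U) '' ((V ∩ orthant n) \ U)) :=
  ⟨0, by rintro _ ⟨u, _, rfl⟩; exact div_nonneg Metric.infDist_nonneg Metric.infDist_nonneg⟩

theorem sharpness_le_one {us : Vec n} (hus : us ∈ optSet W v g)
    (hne : ((affSlice W v ∩ orthant n) \ optSet W v g).Nonempty) :
    sharpness (affSlice W v) (optLevel W v g) (optSet W v g) ≤ 1 := by
  obtain ⟨u, hu⟩ := hne
  refine (csInf_le (bddBelow_sharpness _ _ _) ⟨u, hu, rfl⟩).trans ?_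
  exact div_le_one_of_le₀ (Metric.infDist_le_infDist_of_subset optSet_subset_optLevel ⟨us, hus⟩)
    Metric.infDist_nonneg

/-- Cauchy–Schwarz bound on the distance to the optimal level set. -/
theorem inner_sub_le_norm_mul_infDist_optLevel {us : Vec n} (hus : us ∈ optSet W v g) (u : Vec n) :
    inner ℝ g u - inner ℝ g us ≤ ‖g‖ * Metric.infDist u (affSlice W v ∩ optLevel W v g) := by
  obtain ⟨c, hc⟩ : ∃ c : ℝ, c = inner ℝ g u - inner ℝ g us := ⟨_, rfl⟩
  rw [← hc]
  rcases (norm_nonneg g).eq_or_lt with h0 | h0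
  · have : g = 0 := norm_eq_zero.1 h0.symm
    simp [hc, this]
  · rw [mul_comm, ← div_le_iff₀ h0,
      Metric.le_infDist ⟨us, optSet_subset_optLevel hus⟩]
    rintro w ⟨-, us', hus', hw⟩
    rw [div_le_iff₀ h0, dist_eq_norm, mul_comm, hc, ← inner_eq_of_mem_optSet hus' hus, ← hw,
      ← inner_sub_right]
    exact real_inner_le_norm _ _

/-- Within `affSlice W v` the objective gap is attained by a step along `g`. -/
theorem norm_mul_infDist_optLevel_le (hg : g ∈ W) {us : Vec n} (hus : us ∈ optSet W v g)
    {u : Vec n} (hu : u ∈ affSlice W v) (hgu : inner ℝ g us ≤ inner ℝ g u) :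
    ‖g‖ * Metric.infDist u (affSlice W v ∩ optLevel W v g) ≤ inner ℝ g u - inner ℝ g us := by
  rcases (norm_nonneg g).eq_or_lt with h0 | h0
  · rw [← h0, zero_mul]; linarith
  set t : ℝ := (inner ℝ g u - inner ℝ g us) / ‖g‖ ^ 2 with ht
  have ht0 : 0 ≤ t := div_nonneg (by linarith) (by positivity)
  have hmem : u - t • g ∈ affSlice W v ∩ optLevel W v g := by
    refine ⟨?_, us, hus, ?_⟩
    · have : u - t • g - v = (u - v) - t • g := by abel
      change u - t • g - v ∈ W
      rw [this]
      exact W.sub_mem hu (W.smul_mem _ hg)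
    · rw [inner_sub_right, inner_smul_right, real_inner_self_eq_norm_sq, ht,
        div_mul_cancel₀ _ (by positivity)]
      ring
  have h1 := Metric.infDist_le_dist_of_mem hmem (x := u)
  rw [dist_eq_norm, sub_sub_cancel, norm_smul, Real.norm_of_nonneg ht0] at h1
  calc ‖g‖ * Metric.infDist u (affSlice W v ∩ optLevel W v g) ≤ ‖g‖ * (t * ‖g‖) := by gcongr
    _ = inner ℝ g u - inner ℝ g us := by rw [ht]; field_simp

/-- Hoffman's bound makes the sharpness of a linear program positive. -/
theorem sharpness_pos (hg : g ∈ W) (hg0 : g ≠ 0) {us : Vec n} (hus : us ∈ optSet W v g)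
    (hne : ((affSlice W v ∩ orthant n) \ optSet W v g).Nonempty) :
    0 < sharpness (affSlice W v) (optLevel W v g) (optSet W v g) := by
  obtain ⟨C, hC0, hC⟩ := exists_optSet_error_bound hg hus
  have hgn : 0 < ‖g‖ := norm_pos_iff.2 hg0
  have hpos : 0 < 1 / ((C + 1) * ‖g‖) := by positivity
  refine lt_of_lt_of_le hpos (le_csInf (hne.image _) ?_)
  rintro _ ⟨u, hu, rfl⟩
  have hd : 0 < Metric.infDist u (optSet W v g) :=
    (isClosed_optSet.notMem_iff_infDist_pos ⟨us, hus⟩).1 hu.2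
  rw [div_le_div_iff₀ (by positivity) hd, one_mul]
  have h1 := hC u hu.1
  have h2 := inner_sub_le_norm_mul_infDist_optLevel hus u
  have h3 : (0 : ℝ) ≤ inner ℝ g u - inner ℝ g us := sub_nonneg.2 (hus.2 u hu.1)
  nlinarith

/-- Sharpness bounds the distance of feasible points to the optimal set. -/
theorem sharpness_mul_infDist_le {u : Vec n} (hu : u ∈ affSlice W v ∩ orthant n) :
    sharpness (affSlice W v) (optLevel W v g) (optSet W v g) * Metric.infDist u (optSet W v g)
      ≤ Metric.infDist u (affSlice W v ∩ optLevel W v g) := by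
  by_cases h : u ∈ optSet W v g
  · rw [Metric.infDist_zero_of_mem h, mul_zero]; exact Metric.infDist_nonneg
  · rcases (Metric.infDist_nonneg (x := u) (s := optSet W v g)).eq_or_lt with h0 | h0
    · rw [← h0, mul_zero]; exact Metric.infDist_nonneg
    · rw [← le_div_iff₀ h0]
      exact csInf_le (bddBelow_sharpness _ _ _) ⟨u, ⟨hu, h⟩, rfl⟩

/-- Moving a point `u` of the affine slice towards a nearest optimal point shrinks its distance to
the orthant at least as fast as its distance to the optimal set, so the error ratio near the optimal
set controls the distance of `u` itself to the optimal set. -/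
theorem sharpness_mul_infDist_le_of_supErrorRatio (hg : g ∈ W) (hg0 : g ≠ 0) {us : Vec n}
    (hus : us ∈ optSet W v g) {u : Vec n} (hu : u ∈ affSlice W v) {ε : ℝ} (hε : 0 < ε) :
    sharpness (affSlice W v) (optLevel W v g) (optSet W v g) * (Metric.infDist u (optSet W v g)
        - supErrorRatio (affSlice W v) (optSet W v g) ε * Metric.infDist u (orthant n))
      ≤ supErrorRatio (affSlice W v) (optSet W v g) ε * Metric.infDist u (orthant n)
        + (inner ℝ g u - inner ℝ g us) / ‖g‖ := by
  set S := supErrorRatio (affSlice W v) (optSet W v g) ε with hS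
  set δ := Metric.infDist u (orthant n) with hδ
  set D := Metric.infDist u (optSet W v g) with hD
  set μ := sharpness (affSlice W v) (optLevel W v g) (optSet W v g) with hμ
  have hgn : 0 < ‖g‖ := norm_pos_iff.2 hg0
  have hδ0 : 0 ≤ δ := Metric.infDist_nonneg
  have hD0 : 0 ≤ D := Metric.infDist_nonneg
  have hμ0 : 0 ≤ μ := Real.sInf_nonneg (by
    rintro _ ⟨u, _, rfl⟩; exact div_nonneg Metric.infDist_nonneg Metric.infDist_nonneg)
  obtain ⟨p, hp, hpd⟩ := isClosed_optSet.exists_infDist_eq_dist ⟨us, hus⟩ u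
  obtain ⟨o, ho, hod⟩ := isClosed_orthant.exists_infDist_eq_dist ⟨0, zero_mem_orthant⟩ u
  rw [← hD, dist_eq_norm] at hpd
  rw [← hδ, dist_eq_norm] at hod
  set t : ℝ := min 1 (ε / (D + 1)) with ht
  have ht0 : 0 < t := lt_min one_pos (by positivity)
  have ht1 : t ≤ 1 := min_le_left _ _
  have htD : t * D ≤ ε := by
    have : t * (D + 1) ≤ ε := by
      rw [← le_div_iff₀ (by positivity)]; exact min_le_right _ _
    nlinarith
  set ut := p + t • (u - p) with hut
  have hutV : ut ∈ affSlice W v := by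
    have : ut - v = (1 - t) • (p - v) + t • (u - v) := by rw [hut]; module
    change ut - v ∈ W
    rw [this]
    exact W.add_mem (W.smul_mem _ hp.1.1) (W.smul_mem _ hu)
  have hutU : Metric.infDist ut (optSet W v g) ≤ ε := by
    refine (Metric.infDist_le_dist_of_mem hp).trans ?_
    rw [dist_eq_norm, hut, add_sub_cancel_left, norm_smul, Real.norm_of_nonneg ht0.le, ← hpd]
    exact htD
  have hutO : Metric.infDist ut (orthant n) ≤ t * δ := by
    have hmem : (1 - t) • p + t • o ∈ orthant n :=
      convex_orthant hp.1.2 ho (by linarith) ht0.le (by ring)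
    refine (Metric.infDist_le_dist_of_mem hmem).trans (le_of_eq ?_)
    have : ut - ((1 - t) • p + t • o) = t • (u - o) := by rw [hut]; module
    rw [dist_eq_norm, this, norm_smul, Real.norm_of_nonneg ht0.le, ← hod]
  obtain ⟨f, hf, hfd⟩ := isClosed_feasible.exists_infDist_eq_dist ⟨us, hus.1⟩ ut
  have hS1 : errorRatio (affSlice W v) ut ≤ S := errorRatio_le_supErrorRatio ⟨us, hus.1⟩ hutV hutU
  have hfb : ‖ut - f‖ ≤ t * (S * δ) := by
    rw [← dist_eq_norm, ← hfd]
    calc _ ≤ errorRatio (affSlice W v) ut * Metric.infDist ut (orthant n) :=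
          infDist_feasible_le_errorRatio_mul hutV
      _ ≤ S * (t * δ) := mul_le_mul hS1 hutO Metric.infDist_nonneg
          ((errorRatio_nonneg _ _).trans hS1)
      _ = _ := by ring
  have hgf0 : (inner ℝ g us : ℝ) ≤ inner ℝ g f := hus.2 f hf
  have hgf : inner ℝ g f - inner ℝ g us
      ≤ t * (inner ℝ g u - inner ℝ g us) + ‖g‖ * (t * (S * δ)) := by
    have h1 : (inner ℝ g ut : ℝ) = inner ℝ g us + t * (inner ℝ g u - inner ℝ g us) := by
      rw [hut, inner_add_right, inner_smul_right, inner_sub_right, inner_eq_of_mem_optSet hp hus]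
    have h2 : (inner ℝ g (f - ut) : ℝ) ≤ ‖g‖ * (t * (S * δ)) := by
      refine (real_inner_le_norm _ _).trans ?_
      rw [norm_sub_rev]; gcongr
    rw [inner_sub_right] at h2
    linarith
  -- the distance to the optimal set shrinks by the factor `t`
  have h1 : t * D ≤ ‖ut - f‖ + Metric.infDist f (optSet W v g) := by
    have ha : D ≤ Metric.infDist ut (optSet W v g) + dist u ut :=
      Metric.infDist_le_infDist_add_dist
    have hb : Metric.infDist ut (optSet W v g) ≤ Metric.infDist f (optSet W v g) + dist ut f :=
      Metric.infDist_le_infDist_add_dist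
    have hc : dist u ut = (1 - t) * D := by
      have : u - ut = (1 - t) • (u - p) := by rw [hut]; module
      rw [dist_eq_norm, this, norm_smul, Real.norm_of_nonneg (by linarith), ← hpd]
    rw [dist_eq_norm] at hb
    linarith
  have h2 := sharpness_mul_infDist_le (g := g) hf
  have h3 := norm_mul_infDist_optLevel_le hg hus hf.1 hgf0
  rw [← hμ] at h2
  have h4 : ‖g‖ * (μ * (t * D - t * (S * δ)))
      ≤ t * (inner ℝ g u - inner ℝ g us) + ‖g‖ * (t * (S * δ)) := by
    refine le_trans ?_ hgf
    refine le_trans ?_ h3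
    gcongr
    refine le_trans ?_ h2
    gcongr
    linarith
  have h5 : t * (μ * (D - S * δ)) ≤ t * (S * δ + (inner ℝ g u - inner ℝ g us) / ‖g‖) := by
    rw [← mul_le_mul_iff_right₀ hgn]
    calc _ = ‖g‖ * (μ * (t * D - t * (S * δ))) := by ring
      _ ≤ _ := h4
      _ = _ := by field_simp; ring
  exact le_of_mul_le_mul_left h5 ht0

/-- The distance to the optimal set of a point of the affine slice is bounded by its infeasibility
and its objective gap. -/
theorem sharpness_mul_infDist_optSet_le (hg : g ∈ W) (hg0 : g ≠ 0) {us : Vec n}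
    (hus : us ∈ optSet W v g) {u : Vec n} (hu : u ∈ affSlice W v) :
    sharpness (affSlice W v) (optLevel W v g) (optSet W v g) * (Metric.infDist u (optSet W v g)
        - limitingER (affSlice W v) (optSet W v g) * Metric.infDist u (orthant n))
      ≤ limitingER (affSlice W v) (optSet W v g) * Metric.infDist u (orthant n)
        + (inner ℝ g u - inner ℝ g us) / ‖g‖ := by
  have h := tendsto_supErrorRatio hus
  refine le_of_tendsto_of_tendsto ((tendsto_const_nhds.sub (h.mul_const _)).const_mul _)
    ((h.mul_const _).add_const _) ?_
  filter_upwards [self_mem_nhdsWithin] with ε hε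
  exact (sharpness_mul_infDist_le_of_supErrorRatio hg hg0 hus hu hε)

/-- **Strong duality**: an optimal point has a nonnegative multiplier complementary to it. -/
theorem exists_dual_certificate {x : Vec n} (hx : x ∈ optSet W v g) :
    ∃ s ∈ orthant n, s - g ∈ Wᗮ ∧ inner ℝ s x = (0 : ℝ) := by
  classical
  have hmem : W.orthogonalProjectionOnto g
      ∈ conicHull (coordVec W) (Finset.univ.filter fun i => x i = 0) := by
    refine mem_conicHull_of_forall_inner_nonneg _ _ _ fun d hd => ?_
    -- a small step along `d` is feasible, as `d` is nonnegative where `x` vanishes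
    obtain ⟨t, ht, hfeas⟩ : ∃ t : ℝ, 0 < t ∧ ∀ i, 0 ≤ (x + t • (d : Vec n)) i := by
      have hev : ∀ i, ∀ᶠ t : ℝ in 𝓝[>] 0, 0 ≤ (x + t • (d : Vec n)) i := by
        intro i
        simp only [PiLp.add_apply, PiLp.smul_apply, smul_eq_mul]
        by_cases hi : x i = 0
        · filter_upwards [self_mem_nhdsWithin] with t ht
          have := hd i (by simp [hi])
          rw [inner_coordVec] at this
          rw [hi, zero_add]
          exact mul_nonneg (le_of_lt ht) this
        · have hlt : 0 < x i := lt_of_le_of_ne (hx.1.2 i) (Ne.symm hi)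
          have hcont : Tendsto (fun t : ℝ => x i + t * (d : Vec n) i) (𝓝[>] 0)
              (𝓝 (x i + 0 * (d : Vec n) i)) :=
            ((by fun_prop : Continuous fun t : ℝ =>
              x i + t * (d : Vec n) i).tendsto 0).mono_left nhdsWithin_le_nhds
          rw [zero_mul, add_zero] at hcont
          filter_upwards [hcont.eventually_const_lt hlt] with t ht using ht.le
      obtain ⟨t, h1, h2⟩ := ((Filter.eventually_all.2 hev).and self_mem_nhdsWithin).exists
      exact ⟨t, h2, h1⟩
    have hV : x + t • (d : Vec n) ∈ affSlice W v := by
      have : x + t • (d : Vec n) - v = (x - v) + t • (d : Vec n) := by abel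
      change x + t • (d : Vec n) - v ∈ W
      rw [this]
      exact W.add_mem hx.1.1 (W.smul_mem _ d.2)
    have := hx.2 _ ⟨hV, hfeas⟩
    rw [inner_add_right, inner_smul_right] at this
    rw [real_inner_comm, W.inner_orthogonalProjectionOnto_eq_of_mem_left, real_inner_comm]
    by_contra hneg
    push Not at hneg
    nlinarith
  obtain ⟨l, hl, he⟩ := hmem
  refine ⟨WithLp.toLp 2 fun i => if x i = 0 then l i else 0, fun i => ?_, ?_, ?_⟩
  · simp only; split_ifs
    · exact hl i
    · exact le_rfl
  · rw [Submodule.mem_orthogonal]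
    intro w hw
    have h1 : inner ℝ w g = ∑ i, if x i = 0 then l i * w i else 0 := by
      have := W.inner_orthogonalProjectionOnto_eq_of_mem_left ⟨w, hw⟩ g
      rw [← this, ← he, inner_sum, Finset.sum_filter]
      refine Finset.sum_congr rfl fun i _ => ?_
      split_ifs
      · rw [inner_smul_right, real_inner_comm, inner_coordVec]
      · rfl
    rw [inner_sub_right, h1, PiLp.inner_apply, sub_eq_zero]
    refine Finset.sum_congr rfl fun i _ => ?_
    simp only
    split_ifs <;> simp
  · rw [PiLp.inner_apply]
    refine Finset.sum_eq_zero fun i _ => ?_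
    simp only
    split_ifs with h
    · simp [h]
    · simp

end ConicProgram

/-! ### Duality of orthogonal slices -/

/-! ### Duality of orthogonal slices -/

/-! ### Duality of orthogonal slices -/

/-! ### Duality of orthogonal slices -/

/-! ### Duality of orthogonal slices -/

/-! ### Duality of orthogonal slices -/

section AffineDuality

variable {n : ℕ} {W : Submodule ℝ (Vec n)}

theorem infDist_zero_affSlice {v : Vec n} (hv : v ∈ Wᗮ) :
    Metric.infDist 0 (affSlice W v) = ‖v‖ := by
  have hmem : v ∈ affSlice W v := by simp [affSlice]
  refine le_antisymm ?_ ?_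
  · simpa using Metric.infDist_le_dist_of_mem hmem (x := 0)
  · rw [Metric.le_infDist ⟨v, hmem⟩]
    intro x hx
    have h0 : inner ℝ (x - v) v = (0 : ℝ) := Submodule.inner_right_of_mem_orthogonal hx hv
    have h1 := real_inner_le_norm x v
    rw [inner_sub_left, real_inner_self_eq_norm_mul_norm] at h0
    rw [dist_zero_left]
    rcases (norm_nonneg v).eq_or_lt with h | h
    · rw [← h]; exact norm_nonneg _
    · exact le_of_mul_le_mul_right (by linarith) h

/-- For orthogonal data the complementarity product splits into the two objectives. -/
theorem inner_eq_add_of_mem_affSlice {p d x s : Vec n} (hd : d ∈ W) (hp : p ∈ Wᗮ)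
    (hx : x ∈ affSlice W p) (hs : s ∈ affSlice Wᗮ d) :
    (inner ℝ x s : ℝ) = inner ℝ d x + inner ℝ p s := by
  have h1 : inner ℝ (x - p) (s - d) = (0 : ℝ) := Submodule.inner_right_of_mem_orthogonal hx hs
  have h2 : inner ℝ d p = (0 : ℝ) := Submodule.inner_right_of_mem_orthogonal hd hp
  rw [inner_sub_left, inner_sub_right, inner_sub_right, real_inner_comm d p, h2,
    real_inner_comm d x] at h1
  linarith

/-- The certificate of an optimal point is optimal for the dual program. -/
theorem exists_mem_dual_optSet {p d x : Vec n} (hd : d ∈ W) (hp : p ∈ Wᗮ)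
    (hx : x ∈ optSet W p d) : ∃ s ∈ optSet Wᗮ d p, inner ℝ x s = (0 : ℝ) := by
  obtain ⟨s, hs, hsd, hsx⟩ := exists_dual_certificate hx
  rw [real_inner_comm] at hsx
  refine ⟨s, ⟨⟨hsd, hs⟩, fun s' hs' => ?_⟩, hsx⟩
  have h1 := inner_eq_add_of_mem_affSlice hd hp hx.1.1 hsd
  have h2 := inner_eq_add_of_mem_affSlice hd hp hx.1.1 hs'.1
  have h3 := inner_nonneg_of_mem_orthant hx.1.2 hs'.2
  linarith

/-- Complementary slackness for any pair of optimal points. -/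
theorem inner_eq_zero_of_mem_optSet {p d x s : Vec n} (hd : d ∈ W) (hp : p ∈ Wᗮ)
    (hx : x ∈ optSet W p d) (hs : s ∈ optSet Wᗮ d p) : inner ℝ x s = (0 : ℝ) := by
  obtain ⟨s', hs', h0⟩ := exists_mem_dual_optSet hd hp hx
  have h1 := inner_eq_add_of_mem_affSlice hd hp hx.1.1 hs.1.1
  have h2 := inner_eq_add_of_mem_affSlice hd hp hx.1.1 hs'.1.1
  have h3 := inner_eq_of_mem_optSet hs hs'
  linarith

end AffineDuality

namespace LPData

variable {m n : ℕ} (P : LPData m n)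

theorem adjoint_mulA : P.mulA.adjoint = P.mulAT := by
  rw [mulA, mulAT, ← Matrix.toEuclideanLin_conjTranspose_eq_adjoint,
    Matrix.conjTranspose_eq_transpose_of_trivial]

theorem inner_mulAT_right (x : Vec n) (y : Vec m) :
    (inner ℝ x (P.mulAT y) : ℝ) = inner ℝ (P.mulA x) y := by
  rw [← adjoint_mulA, LinearMap.adjoint_inner_right]

theorem inner_mulAT_left (x : Vec n) (y : Vec m) :
    (inner ℝ (P.mulAT y) x : ℝ) = inner ℝ y (P.mulA x) := by
  rw [← adjoint_mulA, LinearMap.adjoint_inner_left]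

theorem orthogonal_ker_mulA : P.mulA.kerᗮ = P.mulAT.range := by
  rw [LinearMap.orthogonal_ker, adjoint_mulA]

/-! ### Singular values -/

/-- Diagonalization of `x ↦ ‖A x‖²` by right singular vectors. -/
theorem exists_singular_basis (T : Vec n →ₗ[ℝ] Vec m) :
    ∃ u : OrthonormalBasis (Fin n) ℝ (Vec n), ∀ x : Vec n,
      (∀ i : Fin n, inner ℝ (T (u i)) (T x) = T.singularValues i ^ 2 * (inner ℝ (u i) x : ℝ)) ∧
      ‖T x‖ ^ 2 = ∑ i : Fin n, T.singularValues i ^ 2 * (inner ℝ (u i) x : ℝ) ^ 2 := by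
  have hn : Module.finrank ℝ (Vec n) = n := by simp
  have hS := T.isSymmetric_adjoint_comp_self
  refine ⟨hS.eigenvectorBasis hn, fun x => ?_⟩
  set u := hS.eigenvectorBasis hn with hu
  have h1 : ∀ i : Fin n,
      inner ℝ (T (u i)) (T x) = T.singularValues i ^ 2 * (inner ℝ (u i) x : ℝ) := by
    intro i
    have h := hS.apply_eigenvectorBasis hn i
    rw [← hu] at h
    rw [← LinearMap.adjoint_inner_left, ← LinearMap.comp_apply, h,
      ← T.sq_singularValues_fin hn i, inner_smul_left]
    simp
  refine ⟨h1, ?_⟩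
  have hx : T x = ∑ i, (inner ℝ (u i) x : ℝ) • T (u i) := by
    conv_lhs => rw [← u.sum_repr' x]
    rw [map_sum]
    simp only [map_smul]
  rw [← real_inner_self_eq_norm_sq]
  conv_lhs => rw [hx]
  rw [sum_inner, ← hx]
  refine Finset.sum_congr rfl fun i _ => ?_
  rw [inner_smul_left, h1 i]
  simp only [conj_trivial]
  ring

theorem finite_posSingularValues : P.posSingularValues.Finite := by
  refine Set.Finite.subset (P.mulA.singularValues.finite_range) ?_
  rintro s ⟨-, i, rfl⟩
  exact ⟨i, rfl⟩

theorem nonempty_posSingularValues (h : P.mulA ≠ 0) : P.posSingularValues.Nonempty := by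
  by_contra hne
  refine h (P.mulA.singularValues_eq_zero_iff.1 (Finsupp.ext fun i => ?_))
  by_contra h0
  exact hne ⟨_, (P.mulA.singularValues_pos_iff_ne_zero i).2 h0, i, rfl⟩

theorem lammin_mem (h : P.mulA ≠ 0) : P.lammin ∈ P.posSingularValues :=
  (P.nonempty_posSingularValues h).csInf_mem P.finite_posSingularValues

theorem lammin_pos (h : P.mulA ≠ 0) : 0 < P.lammin := (P.lammin_mem h).1

theorem lammin_le_lammax (h : P.mulA ≠ 0) : P.lammin ≤ P.lammax :=
  le_csSup P.finite_posSingularValues.bddAbove (P.lammin_mem h)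

theorem one_le_kappa (h : P.mulA ≠ 0) : 1 ≤ P.kappa :=
  (one_le_div (P.lammin_pos h)).2 (P.lammin_le_lammax h)

theorem lammax_nonneg : 0 ≤ P.lammax := Real.sSup_nonneg fun _ h => h.1.le

theorem norm_mulA_le (x : Vec n) : ‖P.mulA x‖ ≤ P.lammax * ‖x‖ := by
  obtain ⟨u, hu⟩ := exists_singular_basis P.mulA
  refine le_of_sq_le_sq ?_ (mul_nonneg P.lammax_nonneg (norm_nonneg _))
  rw [(hu x).2, mul_pow, ← u.sum_sq_norm_inner_right x, Finset.mul_sum]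
  refine Finset.sum_le_sum fun i _ => ?_
  rw [Real.norm_eq_abs, sq_abs]
  gcongr
  · exact P.mulA.singularValues_nonneg i
  · rcases (P.mulA.singularValues_nonneg i).eq_or_lt with h | h
    · rw [← h]; exact P.lammax_nonneg
    · exact le_csSup P.finite_posSingularValues.bddAbove ⟨h, i, rfl⟩

theorem lammin_mul_norm_le {x : Vec n} (hx : x ∈ P.mulA.kerᗮ) :
    P.lammin * ‖x‖ ≤ ‖P.mulA x‖ := by
  obtain ⟨u, hu⟩ := exists_singular_basis P.mulA
  have hmin0 : 0 ≤ P.lammin := Real.sInf_nonneg fun _ h => h.1.le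
  refine le_of_sq_le_sq ?_ (norm_nonneg _)
  rw [(hu x).2, mul_pow, ← u.sum_sq_norm_inner_right x, Finset.mul_sum]
  refine Finset.sum_le_sum fun i _ => ?_
  rw [Real.norm_eq_abs, sq_abs]
  rcases (P.mulA.singularValues_nonneg i).eq_or_lt with h | h
  · -- a right singular vector with singular value `0` lies in the kernel
    have hk : u i ∈ P.mulA.ker := by
      have := (hu (u i)).1 i
      rw [← h, real_inner_self_eq_norm_sq] at this
      rw [LinearMap.mem_ker, ← norm_eq_zero]
      simpa using this
    rw [Submodule.inner_right_of_mem_orthogonal hk hx]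
    simp
  · gcongr
    exact csInf_le P.finite_posSingularValues.bddBelow ⟨h, i, rfl⟩

/-- Every vector of the range of `A` has a preimage orthogonal to the kernel. -/
theorem exists_orthogonal_preimage (x : Vec n) : ∃ w ∈ P.mulA.kerᗮ, P.mulA w = P.mulA x := by
  refine ⟨x - P.mulA.ker.starProjection x, Submodule.sub_starProjection_mem_orthogonal _, ?_⟩
  rw [map_sub, LinearMap.mem_ker.1 (Submodule.starProjection_apply_mem _ _), sub_zero]

theorem lammin_mul_norm_le_mulAT {y : Vec m} (hy : y ∈ P.mulA.range) :
    P.lammin * ‖y‖ ≤ ‖P.mulAT y‖ := by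
  obtain ⟨x, rfl⟩ := hy
  obtain ⟨w, hw, hwx⟩ := P.exists_orthogonal_preimage x
  rw [← hwx]
  have hmin0 : 0 ≤ P.lammin := Real.sInf_nonneg fun _ h => h.1.le
  rcases (norm_nonneg (P.mulA w)).eq_or_lt with h | h
  · rw [← h, mul_zero]; exact norm_nonneg _
  · refine le_of_mul_le_mul_right ?_ h
    have h1 : ‖P.mulA w‖ * ‖P.mulA w‖ ≤ ‖w‖ * ‖P.mulAT (P.mulA w)‖ := by
      rw [← real_inner_self_eq_norm_mul_norm, ← inner_mulAT_right]
      exact real_inner_le_norm _ _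
    calc P.lammin * ‖P.mulA w‖ * ‖P.mulA w‖ = P.lammin * (‖P.mulA w‖ * ‖P.mulA w‖) := by ring
      _ ≤ P.lammin * (‖w‖ * ‖P.mulAT (P.mulA w)‖) := by gcongr
      _ = P.lammin * ‖w‖ * ‖P.mulAT (P.mulA w)‖ := by ring
      _ ≤ ‖P.mulA w‖ * ‖P.mulAT (P.mulA w)‖ := by gcongr; exact P.lammin_mul_norm_le hw
      _ = _ := by ring

/-! ### The primal and dual programs as slices of the orthant -/

theorem gram_mul_gramPinv_mul : P.A * P.Aᵀ * gramPinv P.A * P.A = P.A := by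
  have hS := gramPinv_spec P.A
  set S := P.A * P.Aᵀ with hSdef
  set G := gramPinv P.A
  have hz : (S * G * P.A - P.A) * (S * G * P.A - P.A)ᵀ = 0 := by
    have e1 : (S * G * P.A - P.A)ᵀ = P.Aᵀ * (S * G) - P.Aᵀ := by
      rw [Matrix.transpose_sub, Matrix.transpose_mul, hS.symm_left]
    rw [e1]
    have e2 : S * G * P.A * (P.Aᵀ * (S * G)) = S * (S * G) := by
      rw [Matrix.mul_assoc (S * G), ← Matrix.mul_assoc P.A, ← hSdef, ← Matrix.mul_assoc (S * G),
        hS.mul_mul_left]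
    have e3 : S * G * P.A * P.Aᵀ = S := by
      rw [Matrix.mul_assoc (S * G), ← hSdef, hS.mul_mul_left]
    have e4 : P.A * (P.Aᵀ * (S * G)) = S * (S * G) := by rw [← Matrix.mul_assoc]
    rw [Matrix.sub_mul, Matrix.mul_sub, Matrix.mul_sub, e2, e3, e4, ← hSdef]
    abel
  rw [← Matrix.conjTranspose_eq_transpose_of_trivial,
    Matrix.self_mul_conjTranspose_eq_zero] at hz
  exact sub_eq_zero.1 hz

theorem q_mem_orthogonal_ker : P.q ∈ P.mulA.kerᗮ := by
  rw [orthogonal_ker_mulA]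
  exact ⟨_, rfl⟩

theorem toEuclideanLin_mul_apply {k l r : ℕ} (M : Matrix (Fin k) (Fin l) ℝ)
    (N : Matrix (Fin l) (Fin r) ℝ) (x : Vec r) :
    Matrix.toEuclideanLin M (Matrix.toEuclideanLin N x) = Matrix.toEuclideanLin (M * N) x := by
  simp [Matrix.toLpLin_apply]

theorem mulA_q {x : Vec n} (hx : P.mulA x = P.b) : P.mulA P.q = P.b := by
  rw [q, ← hx, mulA, mulAT, toEuclideanLin_mul_apply, toEuclideanLin_mul_apply,
    toEuclideanLin_mul_apply, gram_mul_gramPinv_mul]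

theorem Vp_eq {x : Vec n} (hx : P.mulA x = P.b) : P.Vp = affSlice P.mulA.ker P.q := by
  ext u
  change P.mulA u = P.b ↔ u - P.q ∈ P.mulA.ker
  rw [LinearMap.mem_ker, map_sub, P.mulA_q hx, sub_eq_zero]

theorem Vd_eq : P.Vd = affSlice P.mulA.kerᗮ P.c := by
  ext s
  change (∃ y, s = P.c + P.mulAT y) ↔ s - P.c ∈ P.mulA.kerᗮ
  rw [orthogonal_ker_mulA]
  exact ⟨fun ⟨y, h⟩ => ⟨y, by rw [h]; abel⟩, fun ⟨y, h⟩ => ⟨y, by rw [h]; abel⟩⟩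

theorem Xstar_eq {x : Vec n} (hx : P.mulA x = P.b) :
    P.Xstar = optSet P.mulA.ker P.q P.c := by
  rw [Xstar, optSet, Fp, P.Vp_eq hx]

theorem Sstar_eq : P.Sstar = optSet P.mulA.kerᗮ P.c P.q := by
  rw [Sstar, optSet, Fd, P.Vd_eq]
  simp only [inner_sub_right, sub_le_sub_iff_left]

theorem Hp_eq {x : Vec n} (hx : P.mulA x = P.b) : P.Hp = optLevel P.mulA.ker P.q P.c := by
  rw [Hp, optLevel, P.Xstar_eq hx]

theorem Hd_eq : P.Hd = optLevel P.mulA.kerᗮ P.c P.q := by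
  rw [Hd, optLevel, P.Sstar_eq]
  simp only [inner_sub_right, sub_right_inj]

end LPData

namespace LPData

/-! ### The M-norm -/

variable {m n : ℕ} (P : LPData m n)

/-- The bilinear form of the matrix `M`. -/
noncomputable def innerM (τ σ : ℝ) (z w : Vec n × Vec m) : ℝ :=
  inner ℝ z.1 w.1 / τ + inner ℝ z.2 (P.mulA w.1) + inner ℝ w.2 (P.mulA z.1) + inner ℝ z.2 w.2 / σ

/-- Step-sizes with `√(τσ) λ_max ≤ 1/2`, for which `‖·‖_M` is equivalent to the weighted Euclidean
norm with absolute constants. -/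
structure AdmissibleSteps (τ σ : ℝ) : Prop where
  tau_pos : 0 < τ
  sigma_pos : 0 < σ
  mul_le : 4 * (τ * σ) * P.lammax ^ 2 ≤ 1

variable {P} {τ σ : ℝ}

theorem two_mul_abs_inner_mulA_le (h : P.AdmissibleSteps τ σ) (z : Vec n × Vec m) :
    2 * |inner ℝ z.2 (P.mulA z.1)| ≤ (‖z.1‖ ^ 2 / τ + ‖z.2‖ ^ 2 / σ) / 2 := by
  obtain ⟨hτ, hσ, hm⟩ := h
  set X := ‖z.1‖ / √τ with hX
  set Y := ‖z.2‖ / √σ with hY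
  have hs : 0 < √τ := Real.sqrt_pos.2 hτ
  have hr : 0 < √σ := Real.sqrt_pos.2 hσ
  have hX2 : ‖z.1‖ ^ 2 / τ = X ^ 2 := by rw [hX, div_pow, Real.sq_sqrt hτ.le]
  have hY2 : ‖z.2‖ ^ 2 / σ = Y ^ 2 := by rw [hY, div_pow, Real.sq_sqrt hσ.le]
  have hX0 : 0 ≤ X := by positivity
  have hY0 : 0 ≤ Y := by positivity
  have hx : ‖z.1‖ = √τ * X := by rw [hX]; field_simp
  have hy : ‖z.2‖ = √σ * Y := by rw [hY]; field_simp
  have hl : P.lammax * (√τ * √σ) ≤ 1 / 2 := by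
    refine le_of_sq_le_sq ?_ (by norm_num)
    rw [mul_pow, mul_pow, Real.sq_sqrt hτ.le, Real.sq_sqrt hσ.le]
    linarith
  have h1 : |inner ℝ z.2 (P.mulA z.1)| ≤ 1 / 2 * (X * Y) := by
    calc |inner ℝ z.2 (P.mulA z.1)| ≤ ‖z.2‖ * ‖P.mulA z.1‖ := abs_real_inner_le_norm _ _
      _ ≤ ‖z.2‖ * (P.lammax * ‖z.1‖) := by gcongr; exact P.norm_mulA_le _
      _ = P.lammax * (√τ * √σ) * (X * Y) := by rw [hx, hy]; ring
      _ ≤ 1 / 2 * (X * Y) := by gcongr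
  rw [hX2, hY2]
  nlinarith [sq_nonneg (X - Y)]

theorem innerM_self (z : Vec n × Vec m) :
    P.innerM τ σ z z = ‖z.1‖ ^ 2 / τ + 2 * inner ℝ z.2 (P.mulA z.1) + ‖z.2‖ ^ 2 / σ := by
  rw [innerM, real_inner_self_eq_norm_sq, real_inner_self_eq_norm_sq]; ring

theorem half_le_innerM_self (h : P.AdmissibleSteps τ σ) (z : Vec n × Vec m) :
    (‖z.1‖ ^ 2 / τ + ‖z.2‖ ^ 2 / σ) / 2 ≤ P.innerM τ σ z z := by
  have h1 := two_mul_abs_inner_mulA_le h z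
  have h2 := neg_abs_le (inner ℝ z.2 (P.mulA z.1) : ℝ)
  rw [innerM_self]; linarith

theorem innerM_self_le (h : P.AdmissibleSteps τ σ) (z : Vec n × Vec m) :
    P.innerM τ σ z z ≤ 3 / 2 * (‖z.1‖ ^ 2 / τ + ‖z.2‖ ^ 2 / σ) := by
  have h1 := two_mul_abs_inner_mulA_le h z
  have h2 := le_abs_self (inner ℝ z.2 (P.mulA z.1) : ℝ)
  rw [innerM_self]; linarith

theorem innerM_self_nonneg (h : P.AdmissibleSteps τ σ) (z : Vec n × Vec m) :
    0 ≤ P.innerM τ σ z z := by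
  have := h.tau_pos
  have := h.sigma_pos
  exact le_trans (by positivity) (half_le_innerM_self h z)

theorem normM_eq_sqrt (z : Vec n × Vec m) : P.normM τ σ z = √(P.innerM τ σ z z) := by
  rw [normM, innerM_self]

theorem normM_nonneg (z : Vec n × Vec m) : 0 ≤ P.normM τ σ z := Real.sqrt_nonneg _

theorem normM_sq (h : P.AdmissibleSteps τ σ) (z : Vec n × Vec m) :
    P.normM τ σ z ^ 2 = P.innerM τ σ z z := by
  rw [normM_eq_sqrt, Real.sq_sqrt (innerM_self_nonneg h z)]

theorem innerM_add_left (z z' w : Vec n × Vec m) :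
    P.innerM τ σ (z + z') w = P.innerM τ σ z w + P.innerM τ σ z' w := by
  simp only [innerM, Prod.fst_add, Prod.snd_add, inner_add_left, inner_add_right, map_add]; ring

theorem innerM_smul_left (t : ℝ) (z w : Vec n × Vec m) :
    P.innerM τ σ (t • z) w = t * P.innerM τ σ z w := by
  simp only [innerM, Prod.smul_fst, Prod.smul_snd, real_inner_smul_left, real_inner_smul_right,
    map_smul]
  ring

theorem innerM_comm (z w : Vec n × Vec m) : P.innerM τ σ z w = P.innerM τ σ w z := by
  simp only [innerM]
  rw [real_inner_comm z.1, real_inner_comm z.2 w.2]; ring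

theorem innerM_add_right (z w w' : Vec n × Vec m) :
    P.innerM τ σ z (w + w') = P.innerM τ σ z w + P.innerM τ σ z w' := by
  rw [innerM_comm, innerM_add_left, innerM_comm w, innerM_comm w']

theorem innerM_smul_right (t : ℝ) (z w : Vec n × Vec m) :
    P.innerM τ σ z (t • w) = t * P.innerM τ σ z w := by
  rw [innerM_comm, innerM_smul_left, innerM_comm w]

theorem normM_smul (t : ℝ) (z : Vec n × Vec m) : P.normM τ σ (t • z) = |t| * P.normM τ σ z := by
  rw [normM_eq_sqrt, normM_eq_sqrt, innerM_smul_left, innerM_smul_right, ← mul_assoc,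
    Real.sqrt_mul (mul_self_nonneg t), Real.sqrt_mul_self_eq_abs]

theorem normM_neg (z : Vec n × Vec m) : P.normM τ σ (-z) = P.normM τ σ z := by
  rw [← neg_one_smul ℝ z, normM_smul]; simp

theorem normM_sub_comm (z w : Vec n × Vec m) : P.normM τ σ (z - w) = P.normM τ σ (w - z) := by
  rw [← normM_neg, neg_sub]

theorem normM_zero : P.normM τ σ 0 = 0 := by
  have := normM_smul (P := P) (τ := τ) (σ := σ) 0 0
  rwa [zero_smul, abs_zero, zero_mul] at this

/-- Cauchy–Schwarz for `M`. -/
theorem innerM_le (h : P.AdmissibleSteps τ σ) (z w : Vec n × Vec m) :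
    P.innerM τ σ z w ≤ P.normM τ σ z * P.normM τ σ w := by
  have hz := normM_sq h z
  have hw := normM_sq h w
  have key : ∀ s t : ℝ, 0 ≤ s ^ 2 * P.normM τ σ z ^ 2 + 2 * (s * t) * P.innerM τ σ z w
      + t ^ 2 * P.normM τ σ w ^ 2 := by
    intro s t
    have := innerM_self_nonneg h (s • z + t • w)
    rw [innerM_add_left, innerM_add_right, innerM_add_right] at this
    simp only [innerM_smul_left, innerM_smul_right] at this
    rw [innerM_comm w z, ← hz, ← hw] at this
    linarith
  set a := P.normM τ σ z
  set b := P.normM τ σ w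
  have ha : 0 ≤ a := normM_nonneg _
  have hb : 0 ≤ b := normM_nonneg _
  set i := P.innerM τ σ z w
  have hsq : i ^ 2 ≤ (a * b) ^ 2 := by
    rcases ha.eq_or_lt with h0 | h0
    · have k1 := key (-(b ^ 2 + 1)) i
      rw [← h0] at k1 ⊢
      nlinarith [mul_nonneg (sq_nonneg i) (sq_nonneg b)]
    · have k1 := key (-i) (a ^ 2)
      have : 0 ≤ a ^ 2 * ((a * b) ^ 2 - i ^ 2) := by nlinarith
      have := nonneg_of_mul_nonneg_right this (by positivity)
      linarith
  exact (abs_le_of_sq_le_sq' hsq (by positivity)).2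

theorem normM_add_le (h : P.AdmissibleSteps τ σ) (z w : Vec n × Vec m) :
    P.normM τ σ (z + w) ≤ P.normM τ σ z + P.normM τ σ w := by
  refine le_of_sq_le_sq ?_ (add_nonneg (normM_nonneg _) (normM_nonneg _))
  rw [normM_sq h, innerM_add_left, innerM_add_right, innerM_add_right, innerM_comm w z,
    ← normM_sq h z, ← normM_sq h w]
  have := innerM_le h z w
  nlinarith

theorem normM_sub_le (h : P.AdmissibleSteps τ σ) (z w u : Vec n × Vec m) :
    P.normM τ σ (z - u) ≤ P.normM τ σ (z - w) + P.normM τ σ (w - u) := by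
  have := normM_add_le h (z - w) (w - u)
  rwa [sub_add_sub_cancel] at this

/-! ### The primal-dual gap -/

/-- `L(x, ŷ) - L(x̂, y)` for `z = (x, y)` and `w = (x̂, ŷ)`. -/
noncomputable def gap (P : LPData m n) (z w : Vec n × Vec m) : ℝ :=
  P.lagrangian z.1 w.2 - P.lagrangian w.1 z.2

theorem gap_eq (z w : Vec n × Vec m) : P.gap z w =
    inner ℝ (P.b - P.mulA z.1) (w.2 - z.2) + inner ℝ (P.c - P.mulAT z.2) (z.1 - w.1) := by
  simp only [gap, lagrangian, inner_sub_left, inner_sub_right, inner_mulAT_right, inner_mulAT_left]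
  rw [real_inner_comm (P.mulA z.1) z.2, real_inner_comm (P.mulA w.1) z.2]
  ring

theorem gap_swap (z w : Vec n × Vec m) : P.gap w z = -P.gap z w := by
  rw [gap, gap]; ring

theorem gap_self (z : Vec n × Vec m) : P.gap z z = 0 := sub_self _

/-- A saddle point of the Lagrangian over `x ≥ 0`. -/
def IsSaddle (P : LPData m n) (z : Vec n × Vec m) : Prop :=
  z.1 ∈ orthant n ∧ ∀ w : Vec n × Vec m, w.1 ∈ orthant n → P.gap z w ≤ 0

/-- The gap of a multiple of a point, as an affine function of the point: for `S` the sum of `k`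
points this is the sum of their gaps. -/
noncomputable def gapSum (P : LPData m n) (k : ℝ) (S w : Vec n × Vec m) : ℝ :=
  inner ℝ P.c S.1 - inner ℝ S.1 (P.mulAT w.2) - inner ℝ P.b S.2 + inner ℝ w.1 (P.mulAT S.2)
    + k * (inner ℝ P.b w.2 - inner ℝ P.c w.1)

theorem gapSum_zero (w : Vec n × Vec m) : P.gapSum 0 0 w = 0 := by
  simp [gapSum]

theorem gapSum_add (k : ℝ) (S z w : Vec n × Vec m) :
    P.gapSum (k + 1) (S + z) w = P.gapSum k S w + P.gap z w := by
  simp only [gapSum, gap, lagrangian, Prod.fst_add, Prod.snd_add, inner_add_left, inner_add_right,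
    map_add]
  ring

theorem gap_smul {k : ℝ} (hk : k ≠ 0) (S w : Vec n × Vec m) :
    P.gap ((1 / k) • S) w = 1 / k * P.gapSum k S w := by
  simp only [gapSum, gap, lagrangian, Prod.smul_fst, Prod.smul_snd, real_inner_smul_left,
    real_inner_smul_right, map_smul]
  field_simp
  ring

theorem gap_segment (z w : Vec n × Vec m) (t : ℝ) :
    P.gap z (z + t • (w - z)) = t * P.gap z w := by
  rw [gap_eq, gap_eq]
  have e1 : (z + t • (w - z)).2 - z.2 = t • (w.2 - z.2) := by simp
  have e2 : z.1 - (z + t • (w - z)).1 = t • (z.1 - w.1) := by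
    simp only [Prod.fst_add, Prod.smul_fst, Prod.fst_sub]; module
  rw [e1, e2, inner_smul_right, inner_smul_right]; ring

/-! ### One step of PDHG -/

theorem pdhgStep_fst_mem (z : Vec n × Vec m) : (P.pdhgStep τ σ z).1 ∈ orthant n :=
  fun _ => le_max_left _ _

/-- The three-point inequality of PDHG as a proximal-point step in the `M`-norm. -/
theorem gap_pdhgStep_le (h : P.AdmissibleSteps τ σ) (z w : Vec n × Vec m)
    (hw : w.1 ∈ orthant n) :
    P.gap (P.pdhgStep τ σ z) w ≤ 1 / 2 * (P.normM τ σ (z - w) ^ 2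
      - P.normM τ σ (P.pdhgStep τ σ z - w) ^ 2 - P.normM τ σ (z - P.pdhgStep τ σ z) ^ 2) := by
  have hτ := h.tau_pos
  have hσ := h.sigma_pos
  set zp := P.pdhgStep τ σ z with hzp
  have hpol : 1 / 2 * (P.normM τ σ (z - w) ^ 2 - P.normM τ σ (zp - w) ^ 2
      - P.normM τ σ (z - zp) ^ 2) = P.innerM τ σ (z - zp) (zp - w) := by
    have e : z - w = (z - zp) + (zp - w) := by abel
    rw [e, normM_sq h, normM_sq h, normM_sq h, innerM_add_left, innerM_add_right,
      innerM_add_right, innerM_comm (zp - w) (z - zp)]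
    ring
  rw [hpol, gap_eq, innerM]
  set v := z.1 - τ • (P.c - P.mulAT z.2) with hv
  -- the variational inequality of the projection onto the orthant
  have hproj : 0 ≤ inner ℝ (v - zp.1) (zp.1 - w.1) := by
    rw [PiLp.inner_apply]
    refine Finset.sum_nonneg fun i _ => ?_
    have hi : zp.1 i = max 0 (v i) := rfl
    have hwi := hw i
    simp only [PiLp.sub_apply, hi, RCLike.inner_apply, conj_trivial]
    rcases max_cases 0 (v i) with ⟨h1, h2⟩ | ⟨h1, h2⟩
    · rw [h1]; nlinarith
    · rw [h1]; simp
  have hy : (z - zp).2 = -(σ • (P.b - P.mulA ((2 : ℝ) • zp.1 - z.1))) := by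
    change z.2 - (z.2 + σ • (P.b - P.mulA ((2 : ℝ) • zp.1 - z.1))) = _
    abel
  have e4 : (inner ℝ (z - zp).2 (zp - w).2 : ℝ) / σ
      = -inner ℝ (P.b - P.mulA ((2 : ℝ) • zp.1 - z.1)) (zp.2 - w.2) := by
    rw [hy, inner_neg_left, real_inner_smul_left, Prod.snd_sub]; field_simp
  have e1 : (inner ℝ (v - zp.1) (zp.1 - w.1) : ℝ) / τ = inner ℝ (z - zp).1 (zp - w).1 / τ
      - inner ℝ (P.c - P.mulAT z.2) (zp.1 - w.1) := by
    have : v - zp.1 = (z - zp).1 - τ • (P.c - P.mulAT z.2) := by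
      rw [hv, Prod.fst_sub]; abel
    rw [this, inner_sub_left, real_inner_smul_left, Prod.fst_sub, Prod.fst_sub]; field_simp
  have e1' := div_nonneg hproj hτ.le
  rw [e1] at e1'
  have e2 : (inner ℝ (z - zp).2 (P.mulA (zp - w).1) : ℝ)
      = inner ℝ (P.mulAT z.2 - P.mulAT zp.2) (zp.1 - w.1) := by
    rw [← map_sub, inner_mulAT_left]; rfl
  have e3 : (inner ℝ (zp - w).2 (P.mulA (z - zp).1) : ℝ)
      = inner ℝ (P.mulA z.1 - P.mulA zp.1) (zp.2 - w.2) := by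
    rw [real_inner_comm, ← map_sub]; rfl
  rw [e4, e2, e3]
  have e5 : (inner ℝ (P.b - P.mulA zp.1) (w.2 - zp.2) : ℝ)
      = inner ℝ (P.mulA z.1 - P.mulA zp.1) (zp.2 - w.2)
        - inner ℝ (P.b - P.mulA ((2 : ℝ) • zp.1 - z.1)) (zp.2 - w.2) := by
    rw [← inner_sub_left, ← neg_sub zp.2 w.2, inner_neg_right, ← inner_neg_left]
    congr 1
    rw [map_sub, map_smul, two_smul]; abel
  have e6 : (inner ℝ (P.c - P.mulAT zp.2) (zp.1 - w.1) : ℝ)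
      = inner ℝ (P.c - P.mulAT z.2) (zp.1 - w.1)
        + inner ℝ (P.mulAT z.2 - P.mulAT zp.2) (zp.1 - w.1) := by
    rw [← inner_add_left]; congr 1; abel
  rw [e5, e6]
  linarith

/-- PDHG does not increase the `M`-distance to a saddle point. -/
theorem normM_pdhgStep_sub_le (h : P.AdmissibleSteps τ σ) (z : Vec n × Vec m) {zs : Vec n × Vec m}
    (hs : P.IsSaddle zs) : P.normM τ σ (P.pdhgStep τ σ z - zs) ≤ P.normM τ σ (z - zs) := by
  have h1 := gap_pdhgStep_le h z zs hs.1
  have h2 := hs.2 _ (P.pdhgStep_fst_mem (τ := τ) (σ := σ) z)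
  rw [gap_swap] at h2
  refine le_of_sq_le_sq ?_ (normM_nonneg _)
  nlinarith [sq_nonneg (P.normM τ σ (z - P.pdhgStep τ σ z))]

/-! ### Runs of PDHG and their averages -/

/-- What is known about the current point `cur` and the sum `S` of the iterates after `k` steps of
PDHG from `z₀`. -/
structure IsRun (P : LPData m n) (τ σ : ℝ) (z₀ cur S : Vec n × Vec m) (k : ℕ) : Prop where
  sum_fst_mem : S.1 ∈ orthant n
  gapSum_le : ∀ w : Vec n × Vec m, w.1 ∈ orthant n →
    P.gapSum k S w ≤ 1 / 2 * (P.normM τ σ (z₀ - w) ^ 2 - P.normM τ σ (cur - w) ^ 2)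
  cur_le : ∀ zs, P.IsSaddle zs → P.normM τ σ (cur - zs) ≤ P.normM τ σ (z₀ - zs)
  sum_le : ∀ zs, P.IsSaddle zs →
    P.normM τ σ (S - (k : ℝ) • zs) ≤ k * P.normM τ σ (z₀ - zs)

theorem isRun_zero (z₀ : Vec n × Vec m) : P.IsRun τ σ z₀ z₀ 0 0 where
  sum_fst_mem := zero_mem_orthant
  gapSum_le w _ := by simp [gapSum_zero]
  cur_le _ _ := le_rfl
  sum_le zs _ := by simp [normM_zero]

theorem IsRun.step (h : P.AdmissibleSteps τ σ) {z₀ cur S : Vec n × Vec m} {k : ℕ}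
    (hr : P.IsRun τ σ z₀ cur S k) :
    P.IsRun τ σ z₀ (P.pdhgStep τ σ cur) (S + P.pdhgStep τ σ cur) (k + 1) where
  sum_fst_mem i := add_nonneg (hr.sum_fst_mem i) (P.pdhgStep_fst_mem (τ := τ) (σ := σ) cur i)
  gapSum_le w hw := by
    have h1 := gap_pdhgStep_le h cur w hw
    have h2 := hr.gapSum_le w hw
    push_cast
    rw [gapSum_add]
    nlinarith [sq_nonneg (P.normM τ σ (cur - P.pdhgStep τ σ cur))]
  cur_le zs hs := (normM_pdhgStep_sub_le h cur hs).trans (hr.cur_le zs hs)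
  sum_le zs hs := by
    have h1 := (normM_pdhgStep_sub_le h cur hs).trans (hr.cur_le zs hs)
    have h2 := hr.sum_le zs hs
    have e : S + P.pdhgStep τ σ cur - ((k + 1 : ℕ) : ℝ) • zs
        = (S - (k : ℝ) • zs) + (P.pdhgStep τ σ cur - zs) := by
      push_cast; module
    rw [e]
    refine (normM_add_le h _ _).trans ?_
    push_cast
    linarith

/-- What is known about the average `avg` of `k` steps of PDHG from `z₀`. -/
structure IsAverage (P : LPData m n) (τ σ : ℝ) (z₀ avg : Vec n × Vec m) (k : ℕ) : Prop where
  fst_mem : avg.1 ∈ orthant n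
  gap_le : ∀ w : Vec n × Vec m, w.1 ∈ orthant n →
    P.gap avg w ≤ 1 / k * (1 / 2 * P.normM τ σ (z₀ - w) ^ 2)
  sub_le : ∀ zs, P.IsSaddle zs → P.normM τ σ (avg - zs) ≤ P.normM τ σ (z₀ - zs)

theorem IsRun.isAverage {z₀ cur S : Vec n × Vec m} {k : ℕ} (hk : 0 < k)
    (hr : P.IsRun τ σ z₀ cur S k) : P.IsAverage τ σ z₀ ((1 / (k : ℝ)) • S) k where
  fst_mem i := by
    have := hr.sum_fst_mem i
    simp only [Prod.smul_fst, PiLp.smul_apply, smul_eq_mul]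
    positivity
  gap_le w hw := by
    rw [gap_smul (by positivity)]
    have := hr.gapSum_le w hw
    gcongr
    nlinarith [sq_nonneg (P.normM τ σ (cur - w))]
  sub_le zs hs := by
    have hk' : (0 : ℝ) < k := by positivity
    have e : (1 / (k : ℝ)) • S - zs = (1 / (k : ℝ)) • (S - (k : ℝ) • zs) := by
      rw [smul_sub, smul_smul, one_div, inv_mul_cancel₀ hk'.ne', one_smul]
    rw [e, normM_smul, abs_of_pos (by positivity)]
    have := hr.sum_le zs hs
    calc 1 / (k : ℝ) * P.normM τ σ (S - (k : ℝ) • zs)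
        ≤ 1 / (k : ℝ) * (k * P.normM τ σ (z₀ - zs)) := by gcongr
      _ = _ := by field_simp

theorem IsAverage.sub_start_le (h : P.AdmissibleSteps τ σ) {z₀ avg : Vec n × Vec m} {k : ℕ}
    (ha : P.IsAverage τ σ z₀ avg k) {zs : Vec n × Vec m} (hs : P.IsSaddle zs) :
    P.normM τ σ (avg - z₀) ≤ 2 * P.normM τ σ (z₀ - zs) := by
  have h1 := normM_sub_le h avg zs z₀
  have h2 := ha.sub_le zs hs
  rw [normM_sub_comm zs z₀] at h1
  linarith

/-- Within the radius of the normalized gap, the gap of an average is at most `2 r² / k`. -/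
theorem IsAverage.gap_le_of_normM_le (h : P.AdmissibleSteps τ σ) {z₀ avg : Vec n × Vec m} {k : ℕ}
    (ha : P.IsAverage τ σ z₀ avg k) {w : Vec n × Vec m} (hw : w.1 ∈ orthant n)
    (hwr : P.normM τ σ (w - avg) ≤ P.normM τ σ (avg - z₀)) :
    P.gap avg w ≤ 2 * P.normM τ σ (avg - z₀) ^ 2 / k := by
  have h1 := ha.gap_le w hw
  have h2 := normM_sub_le h z₀ avg w
  rw [normM_sub_comm z₀ avg, normM_sub_comm avg w] at h2
  have h3 : P.normM τ σ (z₀ - w) ^ 2 ≤ (2 * P.normM τ σ (avg - z₀)) ^ 2 := by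
    refine pow_le_pow_left₀ (normM_nonneg _) ?_ 2
    linarith
  calc P.gap avg w ≤ 1 / k * (1 / 2 * (2 * P.normM τ σ (avg - z₀)) ^ 2) := by
        refine h1.trans ?_; gcongr
    _ = _ := by ring

/-- The normalized duality gap of an average decays like `1 / k`. -/
theorem IsAverage.rho_le (h : P.AdmissibleSteps τ σ) {z₀ avg : Vec n × Vec m} {k : ℕ}
    (ha : P.IsAverage τ σ z₀ avg k) {zs : Vec n × Vec m} (hs : P.IsSaddle zs) :
    P.rho τ σ (P.normM τ σ (avg - z₀)) avg ≤ 4 * P.normM τ σ (z₀ - zs) / k := by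
  have hd := ha.sub_start_le h hs
  have hd0 : 0 ≤ P.normM τ σ (z₀ - zs) := normM_nonneg _
  have hr0 : 0 ≤ P.normM τ σ (avg - z₀) := normM_nonneg _
  have hg : ∀ w : Vec n × Vec m, w.1 ∈ orthant n →
      P.normM τ σ (w - avg) ≤ P.normM τ σ (avg - z₀) →
      P.gap avg w ≤ 2 * P.normM τ σ (avg - z₀) ^ 2 / k := fun w => ha.gap_le_of_normM_le h
  generalize P.normM τ σ (avg - z₀) = r at *
  rw [rho]
  rcases hr0.eq_or_lt with h0 | h0
  · rw [← h0, div_zero, zero_mul]; positivity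
  · have hsup : sSup ((fun w : Vec n × Vec m => P.lagrangian avg.1 w.2 - P.lagrangian w.1 avg.2) ''
        {w | w.1 ∈ orthant n ∧ P.normM τ σ (w - avg) ≤ r}) ≤ 2 * r ^ 2 / k := by
      refine csSup_le ⟨_, avg, ⟨ha.fst_mem, ?_⟩, rfl⟩ ?_
      · rw [sub_self, normM_zero]; exact h0.le
      · rintro _ ⟨w, ⟨hw1, hw2⟩, rfl⟩
        exact hg w hw1 hw2
    calc _ ≤ 1 / r * (2 * r ^ 2 / k) := by gcongr
      _ = 2 * r / k := by field_simp
      _ ≤ _ := div_le_div_of_nonneg_right (by linarith) (Nat.cast_nonneg k)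

/-- The normalized gap of an average bounds its gap on the ball (the supremum is finite). -/
theorem IsAverage.gap_le_mul_rho (h : P.AdmissibleSteps τ σ) {z₀ avg : Vec n × Vec m} {k : ℕ}
    (ha : P.IsAverage τ σ z₀ avg k) (h0 : 0 < P.normM τ σ (avg - z₀))
    {w : Vec n × Vec m} (hw : w.1 ∈ orthant n)
    (hwr : P.normM τ σ (w - avg) ≤ P.normM τ σ (avg - z₀)) :
    P.gap avg w ≤ P.normM τ σ (avg - z₀) * P.rho τ σ (P.normM τ σ (avg - z₀)) avg := by
  rw [rho, ← mul_assoc, mul_one_div_cancel h0.ne', one_mul]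
  refine le_csSup ⟨2 * P.normM τ σ (avg - z₀) ^ 2 / k, ?_⟩ ⟨w, ⟨hw, hwr⟩, rfl⟩
  rintro _ ⟨w', ⟨hw1, hw2⟩, rfl⟩
  exact ha.gap_le_of_normM_le h hw1 hw2

theorem IsAverage.rho_nonneg (h : P.AdmissibleSteps τ σ) {z₀ avg : Vec n × Vec m} {k : ℕ}
    (ha : P.IsAverage τ σ z₀ avg k) : 0 ≤ P.rho τ σ (P.normM τ σ (avg - z₀)) avg := by
  rcases (normM_nonneg (P := P) (τ := τ) (σ := σ) (avg - z₀)).eq_or_lt with h0 | h0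
  · rw [rho, ← h0, div_zero, zero_mul]
  · have := ha.gap_le_mul_rho h h0 ha.fst_mem (by rw [sub_self, normM_zero]; exact h0.le)
    rw [gap_self] at this
    exact nonneg_of_mul_nonneg_right this h0

/-- If the average equals the starting point in the `M`-norm, its gap is nonpositive. -/
theorem IsAverage.gap_nonpos (h : P.AdmissibleSteps τ σ) {z₀ avg : Vec n × Vec m} {k : ℕ}
    (ha : P.IsAverage τ σ z₀ avg k) (h0 : P.normM τ σ (avg - z₀) = 0)
    {w : Vec n × Vec m} (hw : w.1 ∈ orthant n) : P.gap avg w ≤ 0 := by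
  -- compare linear growth of the gap with quadratic growth of its bound along a segment
  have hseg : ∀ t : ℝ, 0 < t → t ≤ 1 →
      t * P.gap avg w ≤ t * (t * (1 / k * (1 / 2 * P.normM τ σ (w - avg) ^ 2))) := by
    intro t ht ht1
    have hmem : (avg + t • (w - avg)).1 ∈ orthant n := by
      have := convex_orthant ha.fst_mem hw (sub_nonneg.2 ht1) ht.le (by ring)
      convert this using 1
      simp only [Prod.fst_add, Prod.smul_fst, Prod.fst_sub]; module
    have h1 := ha.gap_le _ hmem
    rw [gap_segment] at h1
    have h2 : P.normM τ σ (z₀ - (avg + t • (w - avg))) ≤ t * P.normM τ σ (w - avg) := by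
      have := normM_sub_le h z₀ avg (avg + t • (w - avg))
      rw [normM_sub_comm z₀ avg, h0, sub_add_cancel_left, normM_neg, normM_smul, abs_of_pos ht,
        zero_add] at this
      exact this
    calc t * P.gap avg w ≤ 1 / k * (1 / 2 * (t * P.normM τ σ (w - avg)) ^ 2) := by
          refine h1.trans ?_
          have := pow_le_pow_left₀ (normM_nonneg _) h2 2
          gcongr
      _ = _ := by ring
  have hlim : Tendsto (fun t : ℝ => t * (1 / k * (1 / 2 * P.normM τ σ (w - avg) ^ 2)))
      (𝓝[>] 0) (𝓝 0) := by
    have : Tendsto (fun t : ℝ => t * (1 / k * (1 / 2 * P.normM τ σ (w - avg) ^ 2)))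
      (𝓝 0) (𝓝 (0 * (1 / k * (1 / 2 * P.normM τ σ (w - avg) ^ 2)))) :=
      tendsto_id.mul_const _
    rw [zero_mul] at this
    exact this.mono_left nhdsWithin_le_nhds
  refine ge_of_tendsto hlim ?_
  filter_upwards [Ioo_mem_nhdsGT (one_pos : (0 : ℝ) < 1)] with t ht
  exact le_of_mul_le_mul_left (hseg t ht.1 ht.2.le) ht.1

end LPData

namespace LPData

variable {m n : ℕ} {P : LPData m n} {τ σ : ℝ}

/-! ### Condition measures and saddle points of the linear program -/

theorem Assumption.exists_mulA_eq (hP : P.Assumption) : ∃ x, P.mulA x = P.b := by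
  obtain ⟨x, hx⟩ := hP.exists_optimal
  exact ⟨x, hx.1.1⟩

theorem Assumption.exists_mem_optSet (hP : P.Assumption) :
    ∃ x, x ∈ optSet P.mulA.ker P.q P.c := by
  obtain ⟨x, hx⟩ := hP.exists_optimal
  exact ⟨x, P.Xstar_eq (x := x) hx.1.1 ▸ hx⟩

theorem Assumption.exists_mem_dual_optSet (hP : P.Assumption) (hc : P.mulA P.c = 0) :
    ∃ s, s ∈ optSet P.mulA.kerᗮ P.c P.q := by
  obtain ⟨x, hx⟩ := hP.exists_mem_optSet
  obtain ⟨s, hs, -⟩ := _root_.exists_mem_dual_optSet (LinearMap.mem_ker.2 hc)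
    P.q_mem_orthogonal_ker hx
  exact ⟨s, hs⟩

theorem Assumption.c_ne_zero (hP : P.Assumption) : P.c ≠ 0 := by
  intro h
  obtain ⟨x, hx, hx'⟩ := hP.exists_nonoptimal_primal
  exact hx' ⟨hx, by simp [h]⟩

theorem Assumption.q_ne_zero (hP : P.Assumption) : P.q ≠ 0 := by
  intro h
  obtain ⟨s, hs, hs'⟩ := hP.exists_nonoptimal_dual
  exact hs' ⟨hs, by simp [h]⟩

theorem Assumption.mulA_ne_zero (hP : P.Assumption) : P.mulA ≠ 0 := by
  intro h
  have hq := P.q_mem_orthogonal_ker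
  rw [h, LinearMap.ker_zero, Submodule.top_orthogonal_eq_bot, Submodule.mem_bot] at hq
  exact hP.q_ne_zero hq

theorem Assumption.mup_eq (hP : P.Assumption) : P.mup = sharpness (affSlice P.mulA.ker P.q)
    (optLevel P.mulA.ker P.q P.c) (optSet P.mulA.ker P.q P.c) := by
  obtain ⟨x, hx⟩ := hP.exists_mulA_eq
  rw [mup, P.Vp_eq hx, P.Hp_eq hx, P.Xstar_eq hx]

theorem mud_eq : P.mud = sharpness (affSlice P.mulA.kerᗮ P.c)
    (optLevel P.mulA.kerᗮ P.c P.q) (optSet P.mulA.kerᗮ P.c P.q) := by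
  rw [mud, P.Vd_eq, P.Hd_eq, P.Sstar_eq]

theorem Assumption.nonempty_primal (hP : P.Assumption) :
    ((affSlice P.mulA.ker P.q ∩ orthant n) \ optSet P.mulA.ker P.q P.c).Nonempty := by
  obtain ⟨x, hx⟩ := hP.exists_mulA_eq
  have := hP.exists_nonoptimal_primal
  rwa [Fp, P.Vp_eq hx, P.Xstar_eq hx] at this

theorem Assumption.nonempty_dual (hP : P.Assumption) :
    ((affSlice P.mulA.kerᗮ P.c ∩ orthant n) \ optSet P.mulA.kerᗮ P.c P.q).Nonempty := by
  have := hP.exists_nonoptimal_dual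
  rwa [Fd, P.Vd_eq, P.Sstar_eq] at this

theorem Assumption.mup_pos (hP : P.Assumption) (hc : P.mulA P.c = 0) : 0 < P.mup := by
  obtain ⟨x, hx⟩ := hP.exists_mem_optSet
  rw [hP.mup_eq]
  exact sharpness_pos (LinearMap.mem_ker.2 hc) hP.c_ne_zero hx hP.nonempty_primal

theorem Assumption.mup_le_one (hP : P.Assumption) : P.mup ≤ 1 := by
  obtain ⟨x, hx⟩ := hP.exists_mem_optSet
  rw [hP.mup_eq]
  exact sharpness_le_one hx hP.nonempty_primal

theorem Assumption.mud_pos (hP : P.Assumption) (hc : P.mulA P.c = 0) : 0 < P.mud := by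
  obtain ⟨s, hs⟩ := hP.exists_mem_dual_optSet hc
  rw [mud_eq]
  exact sharpness_pos P.q_mem_orthogonal_ker hP.q_ne_zero hs hP.nonempty_dual

theorem Assumption.mud_le_one (hP : P.Assumption) (hc : P.mulA P.c = 0) : P.mud ≤ 1 := by
  obtain ⟨s, hs⟩ := hP.exists_mem_dual_optSet hc
  rw [mud_eq]
  exact sharpness_le_one hs hP.nonempty_dual

theorem Assumption.one_le_thetap (hP : P.Assumption) : 1 ≤ P.thetap := by
  obtain ⟨x, hx⟩ := hP.exists_mulA_eq
  obtain ⟨x', hx'⟩ := hP.exists_mem_optSet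
  rw [thetap, P.Vp_eq hx, P.Xstar_eq hx]
  exact one_le_limitingER hx'

theorem Assumption.one_le_thetad (hP : P.Assumption) (hc : P.mulA P.c = 0) : 1 ≤ P.thetad := by
  obtain ⟨s, hs⟩ := hP.exists_mem_dual_optSet hc
  rw [thetad, P.Vd_eq, P.Sstar_eq]
  exact one_le_limitingER hs

theorem Assumption.infDist_Vp (hP : P.Assumption) : Metric.infDist 0 P.Vp = ‖P.q‖ := by
  obtain ⟨x, hx⟩ := hP.exists_mulA_eq
  rw [P.Vp_eq hx, infDist_zero_affSlice P.q_mem_orthogonal_ker]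

theorem infDist_Vd (hc : P.mulA P.c = 0) : Metric.infDist 0 P.Vd = ‖P.c‖ := by
  rw [P.Vd_eq, infDist_zero_affSlice]
  rw [Submodule.orthogonal_orthogonal]
  exact LinearMap.mem_ker.2 hc

/-- Primal-dual optimal pairs are saddle points of the Lagrangian. -/
theorem isSaddle_of_mem (hc : P.mulA P.c = 0) {z : Vec n × Vec m}
    (hx : z.1 ∈ P.Xstar) (hs : P.c - P.mulAT z.2 ∈ P.Sstar) : P.IsSaddle z := by
  refine ⟨hx.1.2, fun w hw => ?_⟩
  have hb : P.mulA z.1 = P.b := hx.1.1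
  have h0 := inner_eq_zero_of_mem_optSet (LinearMap.mem_ker.2 hc) P.q_mem_orthogonal_ker
    (P.Xstar_eq hb ▸ hx) (P.Sstar_eq ▸ hs)
  have h1 := inner_nonneg_of_mem_orthant hs.1.2 hw
  rw [gap_eq, hb, sub_self, inner_zero_left, inner_sub_right, real_inner_comm z.1, h0]
  linarith

/-! ### From the normalized duality gap to the distance to optimality -/

/-- Weights `k`, `a` with `1/τ = (k a)²` and `1/σ = (k λ_min / a)²`: with `a² = μ_p ‖c‖ / (μ_d ‖q‖)`
they balance the primal against the dual distance to optimality. -/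
structure Scaling (P : LPData m n) (τ σ k a : ℝ) : Prop where
  k_pos : 0 < k
  a_pos : 0 < a
  inv_tau : 1 / τ = (k * a) ^ 2
  inv_sigma : 1 / σ = (k / a * P.lammin) ^ 2
  sq_eq : a ^ 2 = P.mup * ‖P.c‖ / (P.mud * ‖P.q‖)

/-- The weighted sum of the primal and the dual distance to optimality, with the weights `a` and
`1/a` of `Scaling`. -/
noncomputable def weightedDist (P : LPData m n) (a : ℝ) (z : Vec n × Vec m) : ℝ :=
  a * Metric.infDist z.1 P.Xstar + Metric.infDist (P.c - P.mulAT z.2) P.Sstar / a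

theorem weightedDist_nonneg {a : ℝ} (ha : 0 < a) (z : Vec n × Vec m) :
    0 ≤ P.weightedDist a z :=
  add_nonneg (mul_nonneg ha.le Metric.infDist_nonneg) (div_nonneg Metric.infDist_nonneg ha.le)

theorem errD_le_weightedDist {a : ℝ} (ha : 0 < a) (z : Vec n × Vec m) :
    P.errD z ≤ (a + 1 / a) * P.weightedDist a z := by
  have hx : 0 ≤ Metric.infDist z.1 P.Xstar := Metric.infDist_nonneg
  have hs : 0 ≤ Metric.infDist (P.c - P.mulAT z.2) P.Sstar := Metric.infDist_nonneg
  have e : (a + 1 / a) * P.weightedDist a z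
      = Metric.infDist z.1 P.Xstar + Metric.infDist (P.c - P.mulAT z.2) P.Sstar
        + a ^ 2 * Metric.infDist z.1 P.Xstar
        + Metric.infDist (P.c - P.mulAT z.2) P.Sstar / a ^ 2 := by
    rw [weightedDist]; field_simp; ring
  rw [e]
  have h1 : 0 ≤ a ^ 2 * Metric.infDist z.1 P.Xstar := by positivity
  have h2 : 0 ≤ Metric.infDist (P.c - P.mulAT z.2) P.Sstar / a ^ 2 := by positivity
  exact max_le (by linarith) (by linarith)

theorem weightedDist_le_errD {a : ℝ} (ha : 0 < a) (z : Vec n × Vec m) :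
    P.weightedDist a z ≤ (a + 1 / a) * P.errD z := by
  have h1 : Metric.infDist z.1 P.Xstar ≤ P.errD z := le_max_left _ _
  have h2 : Metric.infDist (P.c - P.mulAT z.2) P.Sstar ≤ P.errD z := le_max_right _ _
  rw [weightedDist, add_mul, div_mul_eq_mul_div, one_mul]
  gcongr

/-- Near every point there is a saddle point whose `M`-distance is controlled by the weighted
distance to optimality. -/
theorem exists_isSaddle_normM_sub_le (hP : P.Assumption) (hc : P.mulA P.c = 0)
    (h : P.AdmissibleSteps τ σ) {k a : ℝ} (hk : P.Scaling τ σ k a) (z : Vec n × Vec m) :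
    ∃ zs, P.IsSaddle zs ∧ P.normM τ σ (z - zs) ≤ 5 / 4 * k * P.weightedDist a z := by
  obtain ⟨x₀, hx₀⟩ := hP.exists_mulA_eq
  have hl := P.lammin_pos hP.mulA_ne_zero
  have hk0 := hk.k_pos
  have ha0 := hk.a_pos
  obtain ⟨xs, hxs, hxd⟩ := (P.Xstar_eq hx₀ ▸ isClosed_optSet :
    IsClosed P.Xstar).exists_infDist_eq_dist hP.exists_optimal z.1
  obtain ⟨s₀, hs₀⟩ := hP.exists_mem_dual_optSet hc
  obtain ⟨ss, hss, hsd⟩ := (P.Sstar_eq ▸ isClosed_optSet :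
    IsClosed P.Sstar).exists_infDist_eq_dist ⟨s₀, P.Sstar_eq ▸ hs₀⟩ (P.c - P.mulAT z.2)
  obtain ⟨v, hv⟩ : ∃ v, P.mulAT (P.mulA v) = P.c - P.mulAT z.2 - ss := by
    have hmem : P.c - P.mulAT z.2 - ss ∈ P.mulA.adjoint.range := by
      rw [adjoint_mulA]
      obtain ⟨y, hy⟩ := hss.1.1
      refine ⟨-z.2 - y, ?_⟩
      rw [hy, map_sub, map_neg]; abel
    rw [← LinearMap.range_adjoint_comp_self, adjoint_mulA] at hmem
    exact hmem
  set η := P.mulA v with hη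
  refine ⟨(xs, z.2 + η), isSaddle_of_mem hc hxs ?_, ?_⟩
  · have : P.c - P.mulAT (z.2 + η) = ss := by rw [map_add, hv]; abel
    rw [this]; exact hss
  · have hηn : P.lammin * ‖η‖ ≤ Metric.infDist (P.c - P.mulAT z.2) P.Sstar := by
      rw [hsd, dist_eq_norm, ← hv]
      exact P.lammin_mul_norm_le_mulAT ⟨v, rfl⟩
    have hW := P.weightedDist_nonneg ha0 z
    refine le_of_sq_le_sq ?_ (by positivity)
    rw [normM_sq h]
    refine (innerM_self_le h _).trans ?_
    have e1 : (z - (xs, z.2 + η)).1 = z.1 - xs := rfl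
    have e2 : (z - (xs, z.2 + η)).2 = -η := by
      change z.2 - (z.2 + η) = -η; abel
    rw [e1, e2, norm_neg, div_eq_mul_one_div (‖z.1 - xs‖ ^ 2), hk.inv_tau,
      div_eq_mul_one_div (‖η‖ ^ 2), hk.inv_sigma, ← dist_eq_norm, ← hxd]
    have hx0 : 0 ≤ Metric.infDist z.1 P.Xstar := Metric.infDist_nonneg
    have hs0 : 0 ≤ Metric.infDist (P.c - P.mulAT z.2) P.Sstar := Metric.infDist_nonneg
    have h1 : ‖η‖ ^ 2 * (k / a * P.lammin) ^ 2
        ≤ (k / a * Metric.infDist (P.c - P.mulAT z.2) P.Sstar) ^ 2 := by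
      rw [← mul_pow]
      refine pow_le_pow_left₀ (by positivity) ?_ 2
      calc ‖η‖ * (k / a * P.lammin) = k / a * (P.lammin * ‖η‖) := by ring
        _ ≤ _ := by gcongr
    have h2 : (5 / 4 * k * P.weightedDist a z) ^ 2 = 25 / 16 * (k * (a * Metric.infDist z.1 P.Xstar)
        + k / a * Metric.infDist (P.c - P.mulAT z.2) P.Sstar) ^ 2 := by
      rw [weightedDist]; ring
    rw [h2]
    -- `3/2 (u² + v²) ≤ 25/16 (u + v)²` for `u, v ≥ 0`
    have h3 : 0 ≤ k * (a * Metric.infDist z.1 P.Xstar) := by positivity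
    have h4 : 0 ≤ k / a * Metric.infDist (P.c - P.mulAT z.2) P.Sstar := by positivity
    nlinarith [mul_nonneg h3 h4]

/-- A bound on the gap over an `M`-ball bounds the primal residual. -/
theorem norm_residual_le (h : P.AdmissibleSteps τ σ) {k a : ℝ} (hk : P.Scaling τ σ k a)
    (hl : 0 < P.lammin) {z : Vec n × Vec m} (hz : z.1 ∈ orthant n) {r δ : ℝ} (hr : 0 < r)
    (hδ : 0 ≤ δ) (hgap : ∀ w : Vec n × Vec m, w.1 ∈ orthant n → P.normM τ σ (w - z) ≤ r →
      P.gap z w ≤ r * δ) : ‖P.b - P.mulA z.1‖ ≤ k / a * P.lammin * δ := by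
  have hk0 := hk.k_pos
  have ha0 := hk.a_pos
  have hσ := h.sigma_pos
  set v := P.b - P.mulA z.1 with hv
  rcases (norm_nonneg v).eq_or_lt with h0 | h0
  · rw [← h0]; positivity
  have hw : k / a * P.lammin > 0 := by positivity
  set t := r / (k / a * P.lammin * ‖v‖) with ht
  have ht0 : 0 < t := by positivity
  have hg := hgap (z.1, z.2 + t • v) hz (by
    refine le_of_sq_le_sq ?_ hr.le
    rw [normM_sq h, innerM_self]
    have e1 : ((z.1, z.2 + t • v) - z).1 = 0 := sub_self _
    have e2 : ((z.1, z.2 + t • v) - z).2 = t • v := add_sub_cancel_left _ _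
    rw [e1, e2, norm_smul, Real.norm_of_nonneg ht0.le, map_zero, inner_zero_right,
      div_eq_mul_one_div _ σ, hk.inv_sigma, ht]
    refine le_of_eq ?_
    rw [norm_zero]
    field_simp
    ring)
  rw [gap_eq] at hg
  simp only [add_sub_cancel_left, sub_self, inner_zero_right, add_zero] at hg
  rw [← hv, real_inner_smul_right, real_inner_self_eq_norm_sq] at hg
  have e : t * ‖v‖ ^ 2 = r * (‖v‖ / (k / a * P.lammin)) := by rw [ht]; field_simp
  rw [e] at hg
  have := le_of_mul_le_mul_left hg hr
  rw [div_le_iff₀ hw] at this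
  linarith

/-- A bound on the gap over an `M`-ball bounds the negative part of the dual slack. -/
theorem infDist_slack_orthant_le (h : P.AdmissibleSteps τ σ) {k a : ℝ} (hk : P.Scaling τ σ k a)
    {z : Vec n × Vec m} (hz : z.1 ∈ orthant n) {r δ : ℝ} (hr : 0 < r)
    (hδ : 0 ≤ δ) (hgap : ∀ w : Vec n × Vec m, w.1 ∈ orthant n → P.normM τ σ (w - z) ≤ r →
      P.gap z w ≤ r * δ) :
    Metric.infDist (P.c - P.mulAT z.2) (orthant n) ≤ k * a * δ := by
  have hk0 := hk.k_pos
  have ha0 := hk.a_pos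
  have hτ := h.tau_pos
  set s := P.c - P.mulAT z.2 with hs
  set v : Vec n := WithLp.toLp 2 fun i => max 0 (-(s i)) with hv
  have hvi : ∀ i, v i = max 0 (-(s i)) := fun i => rfl
  have hsv : s + v ∈ orthant n := fun i => by
    rw [PiLp.add_apply, hvi]
    linarith [le_max_right 0 (-(s i))]
  have hd : Metric.infDist s (orthant n) ≤ ‖v‖ := by
    have := Metric.infDist_le_dist_of_mem hsv (x := s)
    rwa [dist_self_add_right] at this
  refine hd.trans ?_
  have hin : (inner ℝ s v : ℝ) = -‖v‖ ^ 2 := by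
    rw [← real_inner_self_eq_norm_sq, ← inner_neg_left, PiLp.inner_apply, PiLp.inner_apply]
    refine Finset.sum_congr rfl fun i _ => ?_
    simp only [PiLp.neg_apply, hvi, RCLike.inner_apply, conj_trivial]
    rcases max_cases 0 (-(s i)) with ⟨h1, h2⟩ | ⟨h1, h2⟩
    · rw [h1]; ring
    · rw [h1]; ring
  rcases (norm_nonneg v).eq_or_lt with h0 | h0
  · rw [← h0]; positivity
  have hw : k * a > 0 := by positivity
  set t := r / (k * a * ‖v‖) with ht
  have ht0 : 0 < t := by positivity
  have hg := hgap (z.1 + t • v, z.2) (fun i => by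
      rw [PiLp.add_apply, PiLp.smul_apply, hvi, smul_eq_mul]
      have := hz i
      positivity) (by
    refine le_of_sq_le_sq ?_ hr.le
    rw [normM_sq h, innerM_self]
    have e1 : ((z.1 + t • v, z.2) - z).1 = t • v := add_sub_cancel_left _ _
    have e2 : ((z.1 + t • v, z.2) - z).2 = 0 := sub_self _
    rw [e1, e2, norm_smul, Real.norm_of_nonneg ht0.le, inner_zero_left,
      div_eq_mul_one_div _ τ, hk.inv_tau, ht]
    refine le_of_eq ?_
    rw [norm_zero]
    field_simp
    ring)
  rw [gap_eq] at hg
  simp only [sub_add_cancel_left, sub_self, inner_zero_right, zero_add] at hg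
  rw [← hs, inner_neg_right, real_inner_smul_right, hin] at hg
  have e : -(t * -‖v‖ ^ 2) = r * (‖v‖ / (k * a)) := by rw [ht]; field_simp
  rw [e] at hg
  have := le_of_mul_le_mul_left hg hr
  rw [div_le_iff₀ hw] at this
  linarith

/-- A bound on the gap over an `M`-ball bounds the duality gap, by moving towards the origin. -/
theorem objective_gap_le {z : Vec n × Vec m} (hz : z.1 ∈ orthant n) {r δ B : ℝ} (hr : 0 < r)
    (hrB : r ≤ B)
    (hzB : P.normM τ σ z ≤ B)
    (hgap : ∀ w : Vec n × Vec m, w.1 ∈ orthant n → P.normM τ σ (w - z) ≤ r →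
      P.gap z w ≤ r * δ) :
    inner ℝ P.c z.1 - inner ℝ P.b z.2 ≤ B * δ := by
  have hB : 0 < B := hr.trans_le hrB
  set t := r / B with ht
  have ht0 : 0 < t := by positivity
  have ht1 : t ≤ 1 := (div_le_one hB).2 hrB
  have hg := hgap (z + t • (0 - z)) (by
      have := convex_orthant hz zero_mem_orthant (sub_nonneg.2 ht1) ht0.le (by ring)
      convert this using 1
      simp only [Prod.fst_add, Prod.smul_fst, Prod.fst_sub, Prod.fst_zero]; module) (by
    rw [add_sub_cancel_left, normM_smul, zero_sub, normM_neg, abs_of_pos ht0]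
    calc t * P.normM τ σ z ≤ t * B := by gcongr
      _ = r := by rw [ht]; field_simp)
  rw [gap_segment] at hg
  have e : P.gap z 0 = inner ℝ P.c z.1 - inner ℝ P.b z.2 := by simp [gap, lagrangian]
  rw [e] at hg
  have e2 : r * δ = t * (B * δ) := by rw [ht]; field_simp
  rw [e2] at hg
  exact le_of_mul_le_mul_left hg ht0

/-- The primal distance to optimality of a nonnegative point with small residual. -/
theorem mup_mul_infDist_Xstar_le (hP : P.Assumption) (hc : P.mulA P.c = 0) {xs : Vec n}
    (hxs : xs ∈ P.Xstar) {x : Vec n} (hx : x ∈ orthant n) {d : ℝ}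
    (hd : ‖P.b - P.mulA x‖ ≤ P.lammin * d) :
    P.mup * (Metric.infDist x P.Xstar - d - P.thetap * d)
      ≤ P.thetap * d + (inner ℝ P.c x - inner ℝ P.c xs) / ‖P.c‖ := by
  have hb : P.mulA xs = P.b := hxs.1.1
  have hl := P.lammin_pos hP.mulA_ne_zero
  have hcW : P.c ∈ P.mulA.ker := LinearMap.mem_ker.2 hc
  -- project `x` onto the affine subspace, orthogonally to the kernel and hence to `c`
  obtain ⟨w, hw, hwx⟩ := P.exists_orthogonal_preimage (xs - x)
  have hwd : ‖w‖ ≤ d := by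
    refine le_of_mul_le_mul_left ?_ hl
    refine (P.lammin_mul_norm_le hw).trans ?_
    rwa [hwx, map_sub, hb]
  have hmem : x + w ∈ affSlice P.mulA.ker P.q := by
    rw [← P.Vp_eq hb]
    change P.mulA (x + w) = P.b
    rw [map_add, hwx, map_sub, hb]; abel
  have hmain := sharpness_mul_infDist_optSet_le hcW hP.c_ne_zero (P.Xstar_eq hb ▸ hxs) hmem
  rw [← hP.mup_eq, ← P.Xstar_eq hb, ← P.Vp_eq hb, ← thetap, inner_add_right,
    Submodule.inner_right_of_mem_orthogonal hcW hw, add_zero] at hmain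
  have h1 : Metric.infDist (x + w) (orthant n) ≤ d := by
    refine (Metric.infDist_le_dist_of_mem hx).trans ?_
    rwa [dist_self_add_left]
  have h2 : Metric.infDist x P.Xstar ≤ Metric.infDist (x + w) P.Xstar + d := by
    have := Metric.infDist_le_infDist_add_dist (x := x) (y := x + w) (s := P.Xstar)
    rw [dist_self_add_right] at this
    linarith
  have hθ : 0 ≤ P.thetap := zero_le_one.trans hP.one_le_thetap
  have hμ := hP.mup_pos hc
  have h3 : P.thetap * Metric.infDist (x + w) (orthant n) ≤ P.thetap * d := by gcongr
  refine le_trans ?_ (hmain.trans ?_)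
  · gcongr
    linarith
  · gcongr

/-- The dual distance to optimality of a slack close to the orthant. -/
theorem mud_mul_infDist_Sstar_le (hP : P.Assumption) (hc : P.mulA P.c = 0) {ss : Vec n}
    (hss : ss ∈ P.Sstar) (y : Vec m) {d : ℝ}
    (hd : Metric.infDist (P.c - P.mulAT y) (orthant n) ≤ d) :
    P.mud * (Metric.infDist (P.c - P.mulAT y) P.Sstar - P.thetad * d)
      ≤ P.thetad * d + (inner ℝ P.q (P.c - P.mulAT y) - inner ℝ P.q ss) / ‖P.q‖ := by
  have hmem : P.c - P.mulAT y ∈ affSlice P.mulA.kerᗮ P.c := by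
    rw [← P.Vd_eq]; exact ⟨-y, by rw [map_neg]; abel⟩
  have hmain := sharpness_mul_infDist_optSet_le P.q_mem_orthogonal_ker hP.q_ne_zero
    (P.Sstar_eq ▸ hss) hmem
  rw [← mud_eq, ← P.Sstar_eq, ← P.Vd_eq, ← thetad] at hmain
  have hθ : 0 ≤ P.thetad := zero_le_one.trans (hP.one_le_thetad hc)
  have hμ := hP.mud_pos hc
  have h3 : P.thetad * Metric.infDist (P.c - P.mulAT y) (orthant n) ≤ P.thetad * d := by gcongr
  refine le_trans ?_ (hmain.trans ?_)
  · gcongr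
  · gcongr

/-- The primal and dual objective gaps add up to the duality gap. -/
theorem objective_gaps_add (hc : P.mulA P.c = 0) {xs ss : Vec n}
    (hxs : xs ∈ P.Xstar) (hss : ss ∈ P.Sstar) (x : Vec n) (y : Vec m) :
    (inner ℝ P.c x - inner ℝ P.c xs) + (inner ℝ P.q (P.c - P.mulAT y) - inner ℝ P.q ss)
      = (inner ℝ P.c x - inner ℝ P.b y : ℝ) := by
  have hb : P.mulA xs = P.b := hxs.1.1
  have hcW : P.c ∈ P.mulA.ker := LinearMap.mem_ker.2 hc
  have hxs' := P.Xstar_eq hb ▸ hxs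
  have hss' := P.Sstar_eq ▸ hss
  have h0 := inner_eq_zero_of_mem_optSet hcW P.q_mem_orthogonal_ker hxs' hss'
  rw [inner_eq_add_of_mem_affSlice hcW P.q_mem_orthogonal_ker hxs'.1.1 hss'.1.1] at h0
  have h1 : (inner ℝ P.q P.c : ℝ) = 0 := by
    rw [real_inner_comm]
    exact Submodule.inner_right_of_mem_orthogonal hcW P.q_mem_orthogonal_ker
  rw [inner_sub_right, h1, inner_mulAT_right, P.mulA_q hb]
  linarith

/-- The quantity `N̂ / (16 κ)`, with the distances `‖q‖` of `V_p` and `‖c‖` of `V_d` from the origin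
filled in. -/
noncomputable def conditionSum (P : LPData m n) : ℝ :=
  P.thetap / P.mup + P.thetad / P.mud
    + Metric.infDist 0 P.Xstar / (P.mud * ‖P.q‖) + Metric.infDist P.c P.Sstar / (P.mup * ‖P.c‖)

theorem Nhat_eq (hP : P.Assumption) (hc : P.mulA P.c = 0) :
    P.Nhat = 16 * P.kappa * P.conditionSum := by
  rw [Nhat, conditionSum, hP.infDist_Vp, infDist_Vd hc]

theorem two_le_conditionSum (hP : P.Assumption) (hc : P.mulA P.c = 0) : 2 ≤ P.conditionSum := by
  have h1 : 1 ≤ P.thetap / P.mup :=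
    (one_le_div (hP.mup_pos hc)).2 (hP.mup_le_one.trans hP.one_le_thetap)
  have h2 : 1 ≤ P.thetad / P.mud :=
    (one_le_div (hP.mud_pos hc)).2 ((hP.mud_le_one hc).trans (hP.one_le_thetad hc))
  have h3 : 0 ≤ Metric.infDist 0 P.Xstar / (P.mud * ‖P.q‖) :=
    div_nonneg Metric.infDist_nonneg (mul_nonneg (hP.mud_pos hc).le (norm_nonneg _))
  have h4 : 0 ≤ Metric.infDist P.c P.Sstar / (P.mup * ‖P.c‖) :=
    div_nonneg Metric.infDist_nonneg (mul_nonneg (hP.mup_pos hc).le (norm_nonneg _))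
  rw [conditionSum]; linarith

/-- **Sharpness of the normalized duality gap**: if the gap at `z` is at most `r δ` on the `M`-ball
of radius `r`, the weighted distance of `z` to optimality is at most a condition number times `δ`.
The radius and `‖z‖_M` may be as large as twice the norm `5/4 k Dist` of a saddle point near the
origin, which holds for all restart points. -/
theorem weightedDist_le_of_gap_le (hP : P.Assumption) (hc : P.mulA P.c = 0)
    (h : P.AdmissibleSteps τ σ) {k a : ℝ} (hk : P.Scaling τ σ k a)
    {z : Vec n × Vec m} (hz : z.1 ∈ orthant n) {r δ : ℝ} (hr : 0 < r)
    (hrB : r ≤ 5 / 2 * k * P.weightedDist a 0)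
    (hzB : P.normM τ σ z ≤ 5 / 2 * k * P.weightedDist a 0)
    (hδ : 0 ≤ δ) (hgap : ∀ w : Vec n × Vec m, w.1 ∈ orthant n → P.normM τ σ (w - z) ≤ r →
      P.gap z w ≤ r * δ) :
    P.weightedDist a z ≤ 5 / 2 * k * P.conditionSum * δ := by
  have hk0 := hk.k_pos
  have ha0 := hk.a_pos
  have hl := P.lammin_pos hP.mulA_ne_zero
  have hμp := hP.mup_pos hc
  have hμd := hP.mud_pos hc
  have hC : 0 < ‖P.c‖ := norm_pos_iff.2 hP.c_ne_zero
  have hQ : 0 < ‖P.q‖ := norm_pos_iff.2 hP.q_ne_zero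
  obtain ⟨xs, hxs⟩ := hP.exists_optimal
  obtain ⟨ss, hss⟩ := hP.exists_mem_dual_optSet hc
  rw [← P.Sstar_eq] at hss
  have h1 := mup_mul_infDist_Xstar_le hP hc hxs hz (d := k / a * δ)
    ((norm_residual_le h hk hl hz hr hδ hgap).trans (le_of_eq (by ring)))
  have h2 := mud_mul_infDist_Sstar_le hP hc hss z.2
    (infDist_slack_orthant_le h hk hz hr hδ hgap)
  have h3 := objective_gap_le hz hr hrB hzB hgap
  rw [← objective_gaps_add hc hxs hss] at h3
  have hsq := hk.sq_eq
  have hW0 : P.weightedDist a 0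
      = a * Metric.infDist 0 P.Xstar + Metric.infDist P.c P.Sstar / a := by
    simp [weightedDist]
  rw [hW0] at h3
  have hθp := hP.one_le_thetap
  have hθd := hP.one_le_thetad hc
  have hμp1 := hP.mup_le_one
  have hμd1 := hP.mud_le_one hc
  have hcs : P.conditionSum = P.thetap / P.mup + P.thetad / P.mud
    + Metric.infDist 0 P.Xstar / (P.mud * ‖P.q‖) + Metric.infDist P.c P.Sstar / (P.mup * ‖P.c‖) :=
    rfl
  rw [hcs, weightedDist]
  generalize (inner ℝ P.c z.1 - inner ℝ P.c xs : ℝ) = gp at *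
  generalize (inner ℝ P.q (P.c - P.mulAT z.2) - inner ℝ P.q ss : ℝ) = gd at *
  generalize Metric.infDist z.1 P.Xstar = Dx at *
  generalize Metric.infDist (P.c - P.mulAT z.2) P.Sstar = Ds at *
  generalize Metric.infDist 0 P.Xstar = X0 at *
  generalize Metric.infDist P.c P.Sstar = S0 at *
  generalize P.mup = μp at *
  generalize P.mud = μd at *
  generalize P.thetap = θp at *
  generalize P.thetad = θd at *
  generalize ‖P.c‖ = C at *
  generalize ‖P.q‖ = Q at *
  -- the weights make the coefficients of the two objective gaps equal
  have hbal : a / (μp * C) = 1 / (a * (μd * Q)) := by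
    rw [eq_div_iff (by positivity)] at hsq
    rw [div_eq_div_iff (by positivity) (by positivity)]
    nlinarith
  set η := a / (μp * C) with hη
  have hη0 : 0 < η := by positivity
  have hX : a * Dx ≤ k * δ * (1 + θp + θp / μp) + gp * η := by
    have : Dx - k / a * δ - θp * (k / a * δ) ≤ (θp * (k / a * δ) + gp / C) / μp := by
      rw [le_div_iff₀ hμp]; linarith
    have h' := mul_le_mul_of_nonneg_left this ha0.le
    have e1 : a * (Dx - k / a * δ - θp * (k / a * δ)) = a * Dx - k * δ * (1 + θp) := by
      field_simp; ring
    have e2 : a * ((θp * (k / a * δ) + gp / C) / μp) = k * δ * (θp / μp) + gp * η := by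
      rw [hη]; field_simp
    rw [e1, e2] at h'
    linarith
  have hS : Ds / a ≤ k * δ * (θd + θd / μd) + gd * η := by
    have : Ds - θd * (k * a * δ) ≤ (θd * (k * a * δ) + gd / Q) / μd := by
      rw [le_div_iff₀ hμd]; linarith
    have h' := div_le_div_of_nonneg_right this ha0.le
    have e1 : (Ds - θd * (k * a * δ)) / a = Ds / a - k * δ * θd := by field_simp
    have e2 : (θd * (k * a * δ) + gd / Q) / μd / a = k * δ * (θd / μd) + gd * η := by
      rw [hbal]; field_simp
    rw [e1, e2] at h'
    linarith
  have hG : (gp + gd) * η ≤ 5 / 2 * k * (X0 / (μd * Q) + S0 / (μp * C)) * δ := by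
    have h' := mul_le_mul_of_nonneg_right h3 hη0.le
    have e1 : (a * X0 + S0 / a) * η = X0 / (μd * Q) + S0 / (μp * C) := by
      rw [add_mul]
      congr 1
      · rw [hbal]; field_simp
      · rw [hη]; field_simp
    calc _ ≤ _ := h'
      _ = 5 / 2 * k * ((a * X0 + S0 / a) * η) * δ := by ring
      _ = _ := by rw [e1]
  have hp1 : θp ≤ θp / μp := by rw [le_div_iff₀ hμp]; nlinarith
  have hd1 : θd ≤ θd / μd := by rw [le_div_iff₀ hμd]; nlinarith
  have hkd : 0 ≤ k * δ := by positivity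
  have hfin : k * δ * (1 + θp + θp / μp + (θd + θd / μd))
      ≤ k * δ * (5 / 2 * (θp / μp + θd / μd)) := by
    gcongr
    linarith
  linarith

end LPData

namespace LPData

variable {m n : ℕ} {P : LPData m n} {τ σ : ℝ}

/-! ### Restarts -/

theorem state_succ (P : LPData m n) (τ σ β : ℝ) (t : ℕ) :
    P.state τ σ β (t + 1) = P.advance τ σ β (P.state τ σ β t) :=
  Function.iterate_succ_apply' _ _ _

/-- The starting point of an outer loop, as the average of the previous one, is within a condition
number times its normalized duality gap of optimality. -/
theorem IsAverage.weightedDist_le (hP : P.Assumption) (hc : P.mulA P.c = 0)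
    (h : P.AdmissibleSteps τ σ) {k a : ℝ} (hk : P.Scaling τ σ k a)
    (h0 : 0 < P.weightedDist a 0) {zs : Vec n × Vec m} (hs : P.IsSaddle zs)
    (hzs : P.normM τ σ zs ≤ 5 / 4 * k * P.weightedDist a 0) {prev start : Vec n × Vec m} {j : ℕ}
    (ha : P.IsAverage τ σ prev start j)
    (hprev : P.normM τ σ (prev - zs) ≤ 5 / 4 * k * P.weightedDist a 0) :
    P.weightedDist a start
      ≤ 5 / 2 * k * P.conditionSum * P.rho τ σ (P.normM τ σ (start - prev)) start := by
  have hk0 := hk.k_pos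
  have hn : P.normM τ σ start ≤ 5 / 2 * k * P.weightedDist a 0 := by
    have h1 := normM_add_le h (start - zs) zs
    rw [sub_add_cancel] at h1
    have h2 := ha.sub_le zs hs
    linarith
  have hr : P.normM τ σ (start - prev) ≤ 5 / 2 * k * P.weightedDist a 0 := by
    have := ha.sub_start_le h hs
    linarith
  rcases (normM_nonneg (P := P) (τ := τ) (σ := σ) (start - prev)).eq_or_lt with hz | hz
  · -- here `rho` has the junk value `0`, and `start` is indeed optimal
    have hρ : P.rho τ σ (P.normM τ σ (start - prev)) start = 0 := by
      rw [rho, ← hz, div_zero, zero_mul]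
    rw [hρ]
    refine weightedDist_le_of_gap_le hP hc h hk ha.fst_mem (r := 5 / 2 * k * P.weightedDist a 0)
      (by positivity) le_rfl hn le_rfl fun w hw _ => ?_
    rw [mul_zero]
    exact ha.gap_nonpos h hz.symm hw
  · exact weightedDist_le_of_gap_le hP hc h hk ha.fst_mem hz hr hn (ha.rho_nonneg h)
      fun w hw hwr => ha.gap_le_mul_rho h hz hw hwr

/-- A bound on the number of PDHG steps between two restarts. The factor `25` is `4` (decay of `ρ`
along averages) times `5/4 · 5/2` (from `ρ` to the distance to a saddle point) times
`k² / κ = 2`. -/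
noncomputable def loopBound (P : LPData m n) : ℕ :=
  ⌈25 * Real.exp 1 * P.kappa * P.conditionSum⌉₊

/-- The state of restarted PDHG after `t ≥ 1` steps, while no outer iterate within `ε` of optimality
has been found: a run of PDHG from `start`, which is itself an average of a run from `prev` and
whose normalized duality gap has decreased geometrically. -/
structure Invariant (P : LPData m n) (τ σ k a ε : ℝ) (zs : Vec n × Vec m) (t : ℕ)
    (S : RState m n) : Prop where
  outer_pos : 1 ≤ S.outer
  time_le : t ≤ (S.outer - 1) * P.loopBound + S.inner + 1
  inner_lt : S.inner < P.loopBound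
  isRun : P.IsRun τ σ S.start S.cur S.sum S.inner
  isAverage : ∃ j, P.IsAverage τ σ S.prev S.start j
  prev_le : P.normM τ σ (S.prev - zs) ≤ 5 / 4 * k * P.weightedDist a 0
  rho_le : P.rho τ σ (P.normM τ σ (S.start - S.prev)) S.start
    ≤ Real.exp (1 - S.outer) * (5 * k * P.weightedDist a 0)
  lt_errD : ε < P.errD S.start

theorem loopBound_pos (hP : P.Assumption) (hc : P.mulA P.c = 0) : 0 < P.loopBound := by
  have := two_le_conditionSum hP hc
  have := P.one_le_kappa hP.mulA_ne_zero
  exact Nat.ceil_pos.2 (by positivity)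

/-- A restart takes place before the inner counter reaches `loopBound`. -/
theorem lt_loopBound_of_not_restart (hP : P.Assumption) (hc : P.mulA P.c = 0)
    (h : P.AdmissibleSteps τ σ) {k a : ℝ} (hk : P.Scaling τ σ k a) (hkκ : k ^ 2 = 2 * P.kappa)
    {start avg : Vec n × Vec m} {j : ℕ} (hj : 0 < j) (ha : P.IsAverage τ σ start avg j)
    {ρ : ℝ} (hρ0 : 0 ≤ ρ) (hstart : P.weightedDist a start ≤ 5 / 2 * k * P.conditionSum * ρ)
    (hnot : 1 / Real.exp 1 * ρ < P.rho τ σ (P.normM τ σ (avg - start)) avg) :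
    j < P.loopBound := by
  have hk0 := hk.k_pos
  have hcs := two_le_conditionSum hP hc
  obtain ⟨zs, hs, hzs⟩ := exists_isSaddle_normM_sub_le hP hc h hk start
  have hjr : (0 : ℝ) < j := by positivity
  have h1 : P.normM τ σ (start - zs) ≤ 25 / 4 * P.kappa * P.conditionSum * ρ := by
    calc P.normM τ σ (start - zs) ≤ 5 / 4 * k * (5 / 2 * k * P.conditionSum * ρ) := by
          refine hzs.trans ?_; gcongr
      _ = 25 / 8 * k ^ 2 * P.conditionSum * ρ := by ring
      _ = _ := by rw [hkκ]; ring
  have h2 := hnot.trans_le (ha.rho_le h hs)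
  rw [lt_div_iff₀ hjr] at h2
  have h3 : (j : ℝ) * ρ < 25 * Real.exp 1 * P.kappa * P.conditionSum * ρ := by
    have h4 : 1 / Real.exp 1 * ρ * j < 25 * P.kappa * P.conditionSum * ρ := by linarith
    have h5 := mul_lt_mul_of_pos_left h4 (Real.exp_pos 1)
    have e : Real.exp 1 * (1 / Real.exp 1 * ρ * j) = j * ρ := by field_simp
    rw [e] at h5
    linarith
  have h6 : (j : ℝ) < 25 * Real.exp 1 * P.kappa * P.conditionSum := lt_of_mul_lt_mul_right h3 hρ0
  exact Nat.lt_ceil.2 h6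

theorem Invariant.weightedDist_le (hP : P.Assumption) (hc : P.mulA P.c = 0)
    (h : P.AdmissibleSteps τ σ) {k a ε : ℝ} (hk : P.Scaling τ σ k a)
    (h0 : 0 < P.weightedDist a 0) {zs : Vec n × Vec m} (hs : P.IsSaddle zs)
    (hzs : P.normM τ σ zs ≤ 5 / 4 * k * P.weightedDist a 0) {t : ℕ} {S : RState m n}
    (hI : P.Invariant τ σ k a ε zs t S) : P.weightedDist a S.start
      ≤ 5 / 2 * k * P.conditionSum * P.rho τ σ (P.normM τ σ (S.start - S.prev)) S.start := by
  obtain ⟨j, hj⟩ := hI.isAverage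
  exact hj.weightedDist_le hP hc h hk h0 hs hzs hI.prev_le

/-- The number of outer loops grows at most logarithmically in the accuracy. -/
theorem Invariant.exp_outer_lt (hP : P.Assumption) (hc : P.mulA P.c = 0)
    (h : P.AdmissibleSteps τ σ) {k a ε : ℝ} (hk : P.Scaling τ σ k a) (hkκ : k ^ 2 = 2 * P.kappa)
    (h0 : 0 < P.weightedDist a 0) {zs : Vec n × Vec m} (hs : P.IsSaddle zs)
    (hzs : P.normM τ σ zs ≤ 5 / 4 * k * P.weightedDist a 0) {t : ℕ} {S : RState m n}
    (hI : P.Invariant τ σ k a ε zs t S) : ε * Real.exp (S.outer - 1)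
      < 25 * P.kappa * P.conditionSum * (a + 1 / a) ^ 2 * P.errD 0 := by
  have hk0 := hk.k_pos
  have ha0 := hk.a_pos
  have hcs := two_le_conditionSum hP hc
  have h1 : ε < (a + 1 / a) * (5 / 2 * k * P.conditionSum * (Real.exp (1 - S.outer)
      * (5 * k * ((a + 1 / a) * P.errD 0)))) := by
    refine hI.lt_errD.trans_le ((errD_le_weightedDist ha0 _).trans ?_)
    refine mul_le_mul_of_nonneg_left ?_ (by positivity)
    refine (hI.weightedDist_le hP hc h hk h0 hs hzs).trans ?_
    refine mul_le_mul_of_nonneg_left ?_ (by positivity)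
    refine hI.rho_le.trans ?_
    gcongr
    exact weightedDist_le_errD ha0 0
  have h2 := mul_lt_mul_of_pos_right h1 (Real.exp_pos (S.outer - 1))
  refine h2.trans_le (le_of_eq ?_)
  have e : Real.exp (1 - S.outer) * Real.exp (S.outer - 1) = 1 := by
    rw [← Real.exp_add]; simp
  calc _ = 25 / 2 * k ^ 2 * P.conditionSum * (a + 1 / a) ^ 2 * P.errD 0
        * (Real.exp (1 - S.outer) * Real.exp (S.outer - 1)) := by ring
    _ = _ := by rw [e, hkκ]; ring

/-- The first outer loop consists of a single step. -/
theorem invariant_one (hP : P.Assumption) (hc : P.mulA P.c = 0)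
    (h : P.AdmissibleSteps τ σ) {k a ε : ℝ} {zs : Vec n × Vec m} (hs : P.IsSaddle zs)
    (hzs : P.normM τ σ zs ≤ 5 / 4 * k * P.weightedDist a 0) {β : ℝ}
    (hnr : ¬ P.ReachesAt τ σ β ε 1) : P.Invariant τ σ k a ε zs 1 (P.state τ σ β 1) := by
  have hrun : P.IsRun τ σ 0 (P.pdhgStep τ σ 0) (0 + P.pdhgStep τ σ 0) (0 + 1) :=
    (isRun_zero 0).step h
  have havg := hrun.isAverage zero_lt_one
  have hst : P.state τ σ β 1 = ⟨1, 0, 0, (1 / ((0 + 1 : ℕ) : ℝ)) • (0 + P.pdhgStep τ σ 0),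
      (1 / ((0 + 1 : ℕ) : ℝ)) • (0 + P.pdhgStep τ σ 0), 0⟩ := by
    rw [state_succ]
    exact if_pos (Or.inl ⟨rfl, rfl⟩)
  rw [ReachesAt, hst] at hnr
  rw [hst]
  set z₁ := (1 / ((0 + 1 : ℕ) : ℝ)) • (0 + P.pdhgStep τ σ 0) with hz₁
  have h0zs : P.normM τ σ (0 - zs) = P.normM τ σ zs := by rw [zero_sub, normM_neg]
  refine ⟨le_rfl, by simp, loopBound_pos hP hc, isRun_zero _, ⟨_, havg⟩, ?_, ?_, ?_⟩
  · rw [h0zs]; exact hzs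
  · have h1 := havg.rho_le h hs
    rw [h0zs] at h1
    have e : Real.exp (1 - ((1 : ℕ) : ℝ)) = 1 := by simp
    rw [e]
    refine h1.trans ?_
    rw [Nat.cast_one, div_one]
    linarith
  · by_contra hle
    exact hnr ⟨rfl, not_lt.1 hle⟩

theorem Invariant.succ (hP : P.Assumption) (hc : P.mulA P.c = 0)
    (h : P.AdmissibleSteps τ σ) {k a ε : ℝ} (hk : P.Scaling τ σ k a) (hkκ : k ^ 2 = 2 * P.kappa)
    (h0 : 0 < P.weightedDist a 0) {zs : Vec n × Vec m} (hs : P.IsSaddle zs)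
    (hzs : P.normM τ σ zs ≤ 5 / 4 * k * P.weightedDist a 0) {t : ℕ}
    (hI : P.Invariant τ σ k a ε zs t (P.state τ σ (1 / Real.exp 1) t))
    (hnr : ¬ P.ReachesAt τ σ (1 / Real.exp 1) ε (t + 1)) :
    P.Invariant τ σ k a ε zs (t + 1) (P.state τ σ (1 / Real.exp 1) (t + 1)) := by
  have hW := hI.weightedDist_le hP hc h hk h0 hs hzs
  rw [ReachesAt, state_succ] at hnr
  rw [state_succ]
  generalize P.state τ σ (1 / Real.exp 1) t = S at *
  obtain ⟨hout, htime, hinner, hrun, ⟨j, havg⟩, hprev, hρ, hε⟩ := hI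
  have hρ0 := havg.rho_nonneg h
  have hrun' := hrun.step h
  have havg' := hrun'.isAverage (Nat.succ_pos S.inner)
  set avg := (1 / ((S.inner + 1 : ℕ) : ℝ)) • (S.sum + P.pdhgStep τ σ S.cur) with hdef
  by_cases hR : P.RestartCond τ σ (1 / Real.exp 1) S.outer (S.inner + 1) S.prev S.start avg
  · have hst : P.advance τ σ (1 / Real.exp 1) S =
        ⟨S.outer + 1, 0, S.start, avg, avg, 0⟩ := if_pos hR
    rw [hst] at hnr ⊢
    refine ⟨Nat.succ_pos _, ?_, loopBound_pos hP hc, isRun_zero _, ⟨_, havg'⟩, ?_, ?_, ?_⟩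
    · obtain ⟨N, hN⟩ := Nat.exists_eq_add_of_le' hout
      simp only [hN, Nat.add_sub_cancel] at htime ⊢
      rw [Nat.add_mul, Nat.one_mul]
      omega
    · exact (havg.sub_le zs hs).trans hprev
    · rcases hR with ⟨h0, -⟩ | ⟨-, hR⟩
      · omega
      · refine hR.trans ?_
        calc 1 / Real.exp 1 * P.rho τ σ (P.normM τ σ (S.start - S.prev)) S.start
            ≤ 1 / Real.exp 1 * (Real.exp (1 - S.outer) * (5 * k * P.weightedDist a 0)) := by
              gcongr
          _ = _ := by
              rw [← mul_assoc]
              congr 1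
              rw [one_div, ← Real.exp_neg, ← Real.exp_add]
              congr 1
              push_cast
              ring
    · by_contra hle
      exact hnr ⟨rfl, not_lt.1 hle⟩
  · have hst : P.advance τ σ (1 / Real.exp 1) S =
        ⟨S.outer, S.inner + 1, S.prev, S.start, P.pdhgStep τ σ S.cur,
          S.sum + P.pdhgStep τ σ S.cur⟩ := if_neg hR
    rw [hst]
    refine ⟨hout, ?_, ?_, hrun', ⟨j, havg⟩, hprev, hρ, hε⟩
    · change t + 1 ≤ (S.outer - 1) * P.loopBound + (S.inner + 1) + 1
      omega
    · refine lt_loopBound_of_not_restart hP hc h hk hkκ (Nat.succ_pos _) havg' hρ0 hW ?_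
      by_contra hle
      exact hR (Or.inr ⟨hout, not_lt.1 hle⟩)

/-- The invariant holds as long as the target accuracy has not been reached. -/
theorem invariant_of_not_reachesAt (hP : P.Assumption) (hc : P.mulA P.c = 0)
    (h : P.AdmissibleSteps τ σ) {k a ε : ℝ} (hk : P.Scaling τ σ k a) (hkκ : k ^ 2 = 2 * P.kappa)
    (h0 : 0 < P.weightedDist a 0) {zs : Vec n × Vec m} (hs : P.IsSaddle zs)
    (hzs : P.normM τ σ zs ≤ 5 / 4 * k * P.weightedDist a 0) (t : ℕ)
    (hnr : ∀ t' ≤ t + 1, ¬ P.ReachesAt τ σ (1 / Real.exp 1) ε t') :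
    P.Invariant τ σ k a ε zs (t + 1) (P.state τ σ (1 / Real.exp 1) (t + 1)) := by
  induction t with
  | zero => exact invariant_one hP hc h hs hzs (hnr 1 le_rfl)
  | succ t ih =>
    exact (ih fun t' ht' => hnr t' (by omega)).succ hP hc h hk hkκ h0 hs hzs (hnr _ le_rfl)

/-- The step-sizes of the theorem are admissible, and balanced with the weights `k = √(2κ)` and
`a = √(μ_p ‖c‖ / (μ_d ‖q‖))`. -/
theorem admissibleSteps_and_scaling (hP : P.Assumption) (hc : P.mulA P.c = 0)
    (hτ : τ = P.mud * ‖P.q‖ / (2 * P.kappa * P.mup * ‖P.c‖))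
    (hσ : σ = P.mup * ‖P.c‖ / (2 * P.mud * ‖P.q‖ * P.lammax * P.lammin)) :
    P.AdmissibleSteps τ σ ∧
      P.Scaling τ σ √(2 * P.kappa) √(P.mup * ‖P.c‖ / (P.mud * ‖P.q‖)) := by
  have hμp := hP.mup_pos hc
  have hμd := hP.mud_pos hc
  have hC : 0 < ‖P.c‖ := norm_pos_iff.2 hP.c_ne_zero
  have hQ : 0 < ‖P.q‖ := norm_pos_iff.2 hP.q_ne_zero
  have hmin := P.lammin_pos hP.mulA_ne_zero
  have hmax : 0 < P.lammax := hmin.trans_le (P.lammin_le_lammax hP.mulA_ne_zero)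
  have hκ : P.kappa = P.lammax / P.lammin := rfl
  have hκ0 : 0 < P.kappa := hκ ▸ div_pos hmax hmin
  refine ⟨⟨?_, ?_, ?_⟩, ⟨?_, ?_, ?_, ?_, ?_⟩⟩
  · rw [hτ]; positivity
  · rw [hσ]; positivity
  · rw [hτ, hσ, hκ]
    refine le_of_eq ?_
    field_simp
    norm_num
  · positivity
  · positivity
  · rw [mul_pow, Real.sq_sqrt (by positivity), Real.sq_sqrt (by positivity), hτ]
    field_simp
  · rw [mul_pow, div_pow, Real.sq_sqrt (by positivity), Real.sq_sqrt (by positivity), hσ, hκ]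
    field_simp
  · rw [Real.sq_sqrt (by positivity)]

end LPData

theorem theorem3p2 {m n : ℕ} (P : LPData m n) (hP : P.Assumption)
    (hc : P.mulA P.c = 0)
    (τ σ : ℝ)
    (hτ : τ = P.mud * ‖P.q‖ / (2 * P.kappa * P.mup * ‖P.c‖))
    (hσ : σ = P.mup * ‖P.c‖ / (2 * P.mud * ‖P.q‖ * P.lammax * P.lammin))
    (ε : ℝ) (hε : 0 < ε) :
    ∃ T : ℕ, IsLeast {t : ℕ | P.ReachesAt τ σ (1 / Real.exp 1) ε t} T ∧
      (T : ℝ) ≤ max 0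
        (5 * Real.exp 1 * P.Nhat *
          Real.log (8 * Real.exp 1 * P.Nhat * (P.errD 0 / ε)
            * (1 + P.kappa * (P.mup * ‖P.c‖ / (P.mud * ‖P.q‖)))
            * (1 + P.mud * ‖P.q‖ / (P.mup * ‖P.c‖))) + 1) := by
  obtain ⟨h, hk⟩ := LPData.admissibleSteps_and_scaling hP hc hτ hσ
  have hκ1 := P.one_le_kappa hP.mulA_ne_zero
  have hkκ : √(2 * P.kappa) ^ 2 = 2 * P.kappa := Real.sq_sqrt (by positivity)
  have ha2 := hk.sq_eq
  have ha0 := hk.a_pos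
  have hk0 := hk.k_pos
  have hcs := LPData.two_le_conditionSum hP hc
  have hΦ : P.mud * ‖P.q‖ / (P.mup * ‖P.c‖) = 1 / (P.mup * ‖P.c‖ / (P.mud * ‖P.q‖)) := by
    rw [one_div_div]
  rw [hΦ, ← ha2, LPData.Nhat_eq hP hc]
  generalize √(P.mup * ‖P.c‖ / (P.mud * ‖P.q‖)) = a at *
  generalize √(2 * P.kappa) = k at *
  set X := 8 * Real.exp 1 * (16 * P.kappa * P.conditionSum) * (P.errD 0 / ε)
    * (1 + P.kappa * a ^ 2) * (1 + 1 / a ^ 2) with hX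
  set ℓ := 5 * Real.exp 1 * (16 * P.kappa * P.conditionSum) * Real.log X + 1 with hℓ
  by_cases hE : P.errD 0 ≤ ε
  · -- the starting point is already accurate enough
    exact ⟨0, ⟨⟨rfl, hE⟩, fun _ _ => Nat.zero_le _⟩, by simp⟩
  push Not at hE
  have hE0 : 0 < P.errD 0 := hε.trans hE
  have he1 : 1 ≤ Real.exp 1 := Real.one_le_exp zero_le_one
  have hW0 : 0 < P.weightedDist a 0 := by
    have h1 := LPData.errD_le_weightedDist (P := P) ha0 0
    exact pos_of_mul_pos_right (hE0.trans_le h1) (by positivity)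
  have hΦ4 : (a + 1 / a) ^ 2 ≤ (1 + P.kappa * a ^ 2) * (1 + 1 / a ^ 2) := by
    have e : (a + 1 / a) ^ 2 = (1 + 1 * a ^ 2) * (1 + 1 / a ^ 2) := by field_simp; ring
    rw [e]
    gcongr
  have hX0 : 0 < X := by positivity
  have hX1 : 0 ≤ Real.log X := by
    refine Real.log_nonneg ?_
    have h1 : 1 ≤ P.errD 0 / ε := (one_le_div hε).2 hE.le
    have h2 : 1 ≤ 1 + P.kappa * a ^ 2 := by
      have : 0 ≤ P.kappa * a ^ 2 := by positivity
      linarith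
    have h3 : 1 ≤ 1 + 1 / a ^ 2 := by
      have : 0 ≤ 1 / a ^ 2 := by positivity
      linarith
    have h4 : 1 ≤ 8 * Real.exp 1 := by linarith
    have h5 : 1 ≤ 16 * P.kappa * P.conditionSum := by nlinarith
    exact one_le_mul_of_one_le_of_one_le (one_le_mul_of_one_le_of_one_le
      (one_le_mul_of_one_le_of_one_le (one_le_mul_of_one_le_of_one_le h4 h5) h1) h2) h3
  have hℓ1 : 1 ≤ ℓ := by
    have : 0 ≤ 5 * Real.exp 1 * (16 * P.kappa * P.conditionSum) * Real.log X := by positivity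
    linarith
  obtain ⟨zs, hs, hzs⟩ := LPData.exists_isSaddle_normM_sub_le hP hc h hk 0
  rw [zero_sub, LPData.normM_neg] at hzs
  -- as long as the accuracy is not reached, the number of steps obeys the bound
  have key : ∀ t : ℕ, (∀ t' ≤ t, ¬ P.ReachesAt τ σ (1 / Real.exp 1) ε t') →
      ((t + 1 : ℕ) : ℝ) ≤ ℓ := by
    intro t hnr
    rcases t with _ | t
    · simpa using hℓ1
    have hI := LPData.invariant_of_not_reachesAt hP hc h hk hkκ hW0 hs hzs t hnr
    have hexp := hI.exp_outer_lt hP hc h hk hkκ hW0 hs hzs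
    have hout := hI.outer_pos
    have htime := hI.time_le
    have hinner := hI.inner_lt
    generalize P.state τ σ (1 / Real.exp 1) (t + 1) = S at *
    have hN : (S.outer : ℝ) ≤ Real.log X := by
      rw [Real.le_log_iff_exp_le hX0]
      have e : Real.exp S.outer = Real.exp 1 * Real.exp (S.outer - 1) := by
        rw [← Real.exp_add]; congr 1; ring
      rw [e]
      have h1 : Real.exp (S.outer - 1)
          ≤ 25 * P.kappa * P.conditionSum * (a + 1 / a) ^ 2 * P.errD 0 / ε := by
        rw [le_div_iff₀ hε]; linarith
      calc Real.exp 1 * Real.exp (S.outer - 1)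
          ≤ Real.exp 1 * (25 * P.kappa * P.conditionSum * (a + 1 / a) ^ 2 * P.errD 0 / ε) := by
            gcongr
        _ ≤ Real.exp 1 * (128 * P.kappa * P.conditionSum
              * ((1 + P.kappa * a ^ 2) * (1 + 1 / a ^ 2)) * P.errD 0 / ε) := by
            gcongr
            norm_num
        _ = X := by rw [hX]; ring
    have hK : (P.loopBound : ℝ) ≤ 5 * Real.exp 1 * (16 * P.kappa * P.conditionSum) := by
      have h1 := (Nat.ceil_lt_add_one (a := 25 * Real.exp 1 * P.kappa * P.conditionSum)
        (by positivity)).le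
      have h2 : 1 ≤ Real.exp 1 * P.kappa * P.conditionSum :=
        one_le_mul_of_one_le_of_one_le (one_le_mul_of_one_le_of_one_le he1 hκ1) (by linarith)
      have h3 : (P.loopBound : ℝ) ≤ 25 * Real.exp 1 * P.kappa * P.conditionSum + 1 := h1
      linarith
    have hT : t + 1 + 1 ≤ S.outer * P.loopBound + 1 := by
      obtain ⟨N, hN⟩ := Nat.exists_eq_add_of_le' hout
      rw [hN] at htime ⊢
      rw [Nat.add_sub_cancel] at htime
      rw [Nat.add_mul, Nat.one_mul]
      omega
    calc ((t + 1 + 1 : ℕ) : ℝ) ≤ ((S.outer * P.loopBound + 1 : ℕ) : ℝ) := by exact_mod_cast hT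
      _ = S.outer * P.loopBound + 1 := by push_cast; ring
      _ ≤ Real.log X * (5 * Real.exp 1 * (16 * P.kappa * P.conditionSum)) + 1 := by gcongr
      _ = ℓ := by rw [hℓ]; ring
  have hex : ∃ t, P.ReachesAt τ σ (1 / Real.exp 1) ε t := by
    by_contra hne
    push Not at hne
    have h1 := key ⌈ℓ⌉₊ fun t' _ => hne t'
    have h2 := Nat.le_ceil ℓ
    push_cast at h1
    linarith
  classical
  refine ⟨Nat.find hex, ⟨Nat.find_spec hex, fun t ht => Nat.find_min' hex ht⟩,
    le_max_of_le_right ?_⟩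
  rcases hT : Nat.find hex with _ | t
  · simpa using zero_le_one.trans hℓ1
  · exact key t fun t' ht' => Nat.find_min hex (by omega)
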